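/- Let $d\ge 2$ and let $\varrho,\sigma\in[2,\infty]$ satisfy $$\frac2\varrho+\frac d\sigma\le\frac d2,\qquad \frac1\varrho+\frac{d-1}\sigma<\frac{d-1}2$$ (with $1/\infty=0$). Then for every $\varepsilon>0$ there is a constant $C=C(d,\varrho,\sigma,\varepsilon)$ such that every radial continuous function $g:\mathbb R^d\to\mathbb C$ with $\operatorname{supp} g\subset\{x:|x|\le 1\}$ and $\hat g\in L^1(\mathbb R^d)$ (in particular every smooth radial $g$ supported in the unit ball) satisfies $$\big\|e^{it\Delta}g\big\|_{L^\varrho_tL^\sigma_x(\mathbb R\times\mathbb R^d)}\le C\,\big\|\langle\xi\rangle^{-\frac{d-2}{(d-1)\varrho}+\varepsilon}\,\hat g\big\|_{L^1(\mathbb R^d)}.$$ Here $\hat g(\xi)=\int_{\mathbb R^d}e^{-2\pi i x\cdot\xi}g(x)\,dx$, $\langle\xi\rangle=(1+|\xi|^2)^{1/2}$, and $e^{it\Delta}g$ is the solution of $i\partial_tu+\Delta u=0$, $u(0)=g$, given by $\widehat{e^{it\Delta}g}(\xi)=e^{-4\pi^2it|\xi|^2}\hat g(\xi)$. -/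

import Mathlib

open MeasureTheory
open scoped ENNReal NNReal FourierTransform

noncomputable section

/-- The Japanese bracket `⟨ξ⟩ = (1 + |ξ|²)^{1/2}`. -/
def japaneseBracket {d : ℕ} (ξ : EuclideanSpace ℝ (Fin d)) : ℝ :=
  Real.sqrt (1 + ‖ξ‖ ^ 2)

/-- A function on `ℝ^d` is radial if its value at `x` depends only on `|x|`. -/
def IsRadial {d : ℕ} (g : EuclideanSpace ℝ (Fin d) → ℂ) : Prop :=
  ∀ x y, ‖x‖ = ‖y‖ → g x = g y

/-- The free Schrödinger flow `e^{itΔ} g`, i.e. the solution of `i ∂ₜu + Δu = 0`, `u(0) = g`, as a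
Fourier multiplier. With the normalization `𝓕 g ξ = ∫ e^{-2πi x·ξ} g(x) dx`, the symbol of `Δ` is
`-4π²|ξ|²`, so that of `e^{itΔ}` is `e^{-4π²it|ξ|²}`. -/
def schrodingerFlow {d : ℕ} (t : ℝ) (g : EuclideanSpace ℝ (Fin d) → ℂ) :
    EuclideanSpace ℝ (Fin d) → ℂ :=
  𝓕⁻ (fun ξ : EuclideanSpace ℝ (Fin d) =>
    Complex.exp (-(4 * (Real.pi : ℂ) ^ 2 * Complex.I * (t : ℂ) * ((‖ξ‖ : ℝ) : ℂ) ^ 2)) * 𝓕 g ξ)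

/-- The mixed norm `‖u‖_{L^ϱ_t L^σ_x(ℝ × ℝ^d)}`, with values in `[0, ∞]`. -/
def mixedNorm {d : ℕ} (ϱ σ : ℝ≥0∞) (u : ℝ → EuclideanSpace ℝ (Fin d) → ℂ) : ℝ≥0∞ :=
  eLpNorm (fun t : ℝ => eLpNorm (u t) σ volume) ϱ volume

/-- The weighted norm `‖⟨ξ⟩^s ĝ‖_{L^1_ξ(ℝ^d)}`, with values in `[0, ∞]`. -/
def weightedFourierNorm {d : ℕ} (s : ℝ) (g : EuclideanSpace ℝ (Fin d) → ℂ) : ℝ≥0∞ :=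
  eLpNorm (fun ξ : EuclideanSpace ℝ (Fin d) => ((japaneseBracket ξ ^ s : ℝ) : ℂ) * 𝓕 g ξ) 1 volume

end

/-!
Put `a = 1/ϱ`, `δ = 1 - 2/σ` and write `u(t) = e^{itΔ} g`. The hypotheses enter only through
`a ≤ 1/2`, `δ > 0` and `a < d δ / 2` (`exponent_bounds`), the last one saying that the dispersive
decay `|t|^{-dδ/2}` of the `L^σ` norm is integrable at infinity to the power `ϱ`.

Let `χ` be a smooth cutoff equal to `1` on the unit ball. Since `g` is radial, so is `ĝ`, and
Fourier inversion writes `g = χ g` as the superposition with density `ĝ(ξ)` of the truncated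
spherical waves `χ φ_r`, `r = |ξ|`, where `φ_r` is the mean of `e^{2πi⟪·, η⟫}` over `|η| = r`. By expanding
the square, `‖χ φ_r‖₂²` is a double spherical mean of the rapidly decaying Fourier transform of
`χ²`, and such a mean is `O((1 + r)^{-(d-1)})` (`exists_lintegral_sphere_decay`,
`exists_lintegral_sq_sphericalWave_le`); as `χ` has compact support, `‖χ φ_r‖₁` is
`O((1 + r)^{-(d-1)/2})`. This has two consequences.

* By Minkowski's inequality and Plancherel's identity, `‖u(t)‖₂` is at most a constant times
  `∫ |ĝ(ξ)| (1 + |ξ|)^{-(d-1)/2}` (`exists_eLpNorm_two_le`, `eLpNorm_two_schrodingerFlow_le`).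
* `e^{itΔ}(χ φ_r)` is bounded both by `‖χ̂‖₁` and, by the dispersive estimate, by a constant times
  `|t|^{-d/2} (1 + r)^{-(d-1)/2}` (`norm_sphereMean_packetFlow_le`). Taking a geometric mean of the
  two with exponent `θ` for each frequency separately bounds `‖u(t)‖_∞` by a constant times
  `∫ |ĝ(ξ)| |t|^{-dθ/2} (1 + |ξ|)^{-(d-1)θ/2}` (`exists_norm_integral_gaussianWave_le`).

Interpolating in `L^σ`, with `θ` such that `dθδ/2 = p`, gives `‖u(t)‖_σ ≤ C |t|^{-p} N`, where `N`
is the weighted norm of `ĝ` (`exists_eLpNorm_schrodingerFlow_le`). The weight is admissible because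
`θ ≥ 2p/d` and `(d - 1)/d ≥ (d - 2)/(d - 1)`. The choices `p = a - η` for `|t| ≤ 1` and `p = a + η`
for `|t| ≥ 1` with a small `η > 0` give a function of `t` in `L^ϱ`; if `ϱ = ∞`, then `p = 0` is
enough.
-/

/-! ### Plancherel's identity and radial Fourier transforms -/

section Plancherel

variable {V : Type*} [NormedAddCommGroup V] [InnerProductSpace ℝ V] [FiniteDimensional ℝ V]
  [MeasurableSpace V] [BorelSpace V]

/-- The inverse Fourier transform is self-adjoint for the bilinear pairing. -/
theorem integral_mul_fourierInv_eq {f g : V → ℂ} (hf : Integrable f) (hg : Integrable g) :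
    ∫ x, f x * 𝓕⁻ g x = ∫ ξ, 𝓕⁻ f ξ * g ξ := by
  have h := VectorFourier.integral_fourierIntegral_smul_eq_flip (𝕜 := ℝ) (L := -innerₗ V)
    (μ := volume) (ν := volume) (f := f) (g := g) Real.continuous_fourierChar
    continuous_inner.neg hf hg
  have e : (-innerₗ V).flip = -innerₗ V := by
    ext x y; simp [real_inner_comm]
  rw [e] at h
  exact h.symm

theorem continuous_fourier_of_integrable {g : V → ℂ} (hg : Integrable g) : Continuous (𝓕 g) := by
  have h := VectorFourier.fourierIntegral_continuous (𝕜 := ℝ) (L := innerₗ V)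
    (μ := volume) (f := g) Real.continuous_fourierChar continuous_inner hg
  exact h

theorem continuous_fourierInv_of_integrable {g : V → ℂ} (hg : Integrable g) :
    Continuous (𝓕⁻ g) := by
  have h := VectorFourier.fourierIntegral_continuous (𝕜 := ℝ) (L := -innerₗ V)
    (μ := volume) (f := g) Real.continuous_fourierChar continuous_inner.neg hg
  exact h

/-- Plancherel's identity for the pointwise defined inverse Fourier transform. The integral and the
unitary extension from Schwartz functions agree as tempered distributions, hence almost
everywhere. -/
theorem eLpNorm_fourierInv_two {F : V → ℂ} (hF : Integrable F) (hF2 : MemLp F 2) :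
    eLpNorm (𝓕⁻ F) 2 volume = eLpNorm F 2 volume := by
  set U : Lp ℂ 2 (volume : Measure V) := 𝓕⁻ (hF2.toLp F) with hU
  have hae : ∀ᵐ x ∂(volume : Measure V), 𝓕⁻ F x = U x := by
    apply ae_eq_of_integral_contDiff_smul_eq
      (continuous_fourierInv_of_integrable hF).locallyIntegrable
      ((Lp.memLp U).locallyIntegrable (by norm_num))
    intro ψ hψ hψc
    have hg₁ : HasCompactSupport (Complex.ofRealCLM ∘ ψ) := hψc.comp_left rfl
    have hg₂ : ContDiff ℝ ((⊤ : ℕ∞) : WithTop ℕ∞) (Complex.ofRealCLM ∘ ψ) := by fun_prop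
    set Ψ : SchwartzMap V ℂ := hg₁.toSchwartzMap hg₂ with hΨ
    have hΨa : ∀ x, Ψ x = ((ψ x : ℝ) : ℂ) := fun x => rfl
    have h1 := congrArg (fun T => T Ψ)
      (Lp.fourierInv_toTemperedDistribution_eq (hF2.toLp F))
    simp only [TemperedDistribution.fourierInv_apply, Lp.toTemperedDistribution_apply] at h1
    have h2 : ∫ x, (𝓕⁻ Ψ) x • (hF2.toLp F) x = ∫ x, 𝓕⁻ (Ψ : V → ℂ) x * F x := by
      apply integral_congr_ae
      filter_upwards [hF2.coeFn_toLp] with x hx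
      rw [hx, SchwartzMap.fourierInv_coe]
      rfl
    rw [h2, ← integral_mul_fourierInv_eq Ψ.integrable hF] at h1
    simp only [hΨa, smul_eq_mul] at h1
    simpa using h1
  rw [eLpNorm_congr_ae hae, ← Lp.enorm_def]
  have h3 : ‖U‖ₑ = ‖hF2.toLp F‖ₑ := by
    have : ‖U‖ = ‖hF2.toLp F‖ := (Lp.fourierTransformₗᵢ V ℂ).symm.norm_map _
    simp only [← ofReal_norm, this]
  rw [h3, Lp.enorm_toLp]

/-- Integrable functions with finite supremum are square integrable. -/
theorem MeasureTheory.Integrable.memLp_two_of_bound {F : V → ℂ} (hF : Integrable F) {C : ℝ}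
    (hC : ∀ x, ‖F x‖ ≤ C) : MemLp F 2 := by
  refine (memLp_two_iff_integrable_sq_norm hF.1).2 ?_
  simp only [pow_two]
  exact hF.norm.bdd_mul hF.1.norm (Filter.Eventually.of_forall fun x => by simpa using hC x)

/-- The Fourier transform of a radial function is radial. -/
theorem fourier_eq_of_norm_eq {g : V → ℂ} (hg : ∀ x y, ‖x‖ = ‖y‖ → g x = g y) {ξ η : V}
    (h : ‖ξ‖ = ‖η‖) : 𝓕 g ξ = 𝓕 g η := by
  set A := (Submodule.span ℝ {ξ - η})ᗮ.reflection with hA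
  have h1 : A ξ = η := Submodule.reflection_sub h
  have h2 := Real.fourier_comp_linearIsometry A g ξ
  rw [h1] at h2
  rw [← h2]
  refine congrArg (fun f : V → ℂ => 𝓕 f ξ) (funext fun x => hg _ _ ?_)
  simp

end Plancherel

/-! ### Polar coordinates and means over spheres -/

section Polar

variable {V : Type*} [NormedAddCommGroup V] [InnerProductSpace ℝ V] [FiniteDimensional ℝ V]
  [MeasurableSpace V] [BorelSpace V]

open Set Metric Measure

variable (V) in
/-- The uniform probability measure on the unit sphere. -/
noncomputable def sphereProb : Measure (sphere (0 : V) 1) :=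
  ((volume : Measure V).toSphere univ)⁻¹ • (volume : Measure V).toSphere

instance isProbabilityMeasure_sphereProb [Nontrivial V] : IsProbabilityMeasure (sphereProb V) :=
  ⟨by
    rw [sphereProb, Measure.smul_apply, smul_eq_mul]
    exact ENNReal.inv_mul_cancel
      (measure_univ_ne_zero.2 (toSphere_ne_zero volume)) (measure_ne_top _ _)⟩

theorem toSphere_eq_smul_sphereProb [Nontrivial V] :
    (volume : Measure V).toSphere = ((volume : Measure V).toSphere univ) • sphereProb V := by
  rw [sphereProb, smul_smul, ENNReal.mul_inv_cancel
      (measure_univ_ne_zero.2 (toSphere_ne_zero volume)) (measure_ne_top _ _), one_smul]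

theorem measurePreserving_polar [Nontrivial V] :
    MeasurePreserving (fun p : sphere (0 : V) 1 × Ioi (0 : ℝ) => (p.2 : ℝ) • (p.1 : V))
      ((volume : Measure V).toSphere.prod (volumeIoiPow (Module.finrank ℝ V - 1))) volume := by
  have h1 := (volume : Measure V).measurePreserving_homeomorphUnitSphereProd
  have h2 := MeasurePreserving.symm (homeomorphUnitSphereProd V).toMeasurableEquiv h1
  have h3 : MeasurePreserving (Subtype.val : ({0}ᶜ : Set V) → V)
      ((volume : Measure V).comap Subtype.val) volume := by
    refine ⟨measurable_subtype_coe, ?_⟩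
    rw [map_comap_subtype_coe (measurableSet_singleton _).compl, restrict_compl_singleton]
  have h4 := h3.comp h2
  convert h4 using 1
  ext p
  exact (homeomorphUnitSphereProd_symm_apply_coe V p).symm

theorem lintegral_polar [Nontrivial V] {f : V → ℝ≥0∞} (hf : Measurable f) :
    ∫⁻ x, f x = ∫⁻ r in Ioi (0 : ℝ), ENNReal.ofReal (r ^ (Module.finrank ℝ V - 1)) *
      ∫⁻ ω : sphere (0 : V) 1, f (r • (ω : V)) ∂(volume : Measure V).toSphere := by
  rw [← measurePreserving_polar.lintegral_comp hf, lintegral_prod_symm' _ (by fun_prop)]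
  have hm : Measurable fun r : ℝ =>
      ∫⁻ ω : sphere (0 : V) 1, f (r • (ω : V)) ∂(volume : Measure V).toSphere :=
    Measurable.lintegral_prod_right' (f := fun p : ℝ × sphere (0 : V) 1 => f (p.1 • (p.2 : V)))
      (by fun_prop)
  rw [volumeIoiPow]
  refine (lintegral_withDensity_eq_lintegral_mul _ (by fun_prop)
    (hm.comp measurable_subtype_coe)).trans ?_
  exact lintegral_subtype_comap measurableSet_Ioi (fun r : ℝ =>
    ENNReal.ofReal (r ^ (Module.finrank ℝ V - 1)) *
      ∫⁻ ω : sphere (0 : V) 1, f (r • (ω : V)) ∂(volume : Measure V).toSphere)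

theorem integral_polar [Nontrivial V] {f : V → ℂ} (hf : Integrable f) :
    ∫ x, f x = ∫ r : Ioi (0 : ℝ), ∫ ω : sphere (0 : V) 1, f ((r : ℝ) • (ω : V))
      ∂(volume : Measure V).toSphere ∂volumeIoiPow (Module.finrank ℝ V - 1) := by
  have h := measurePreserving_polar (V := V)
  rw [← integral_prod_symm (fun p : sphere (0 : V) 1 × Ioi (0 : ℝ) => f ((p.2 : ℝ) • (p.1 : V)))
    ((h.integrable_comp hf.1).2 hf)]
  conv_lhs => rw [← h.map_eq]
  exact integral_map h.measurable.aemeasurable (by rw [h.map_eq]; exact hf.1)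

/-- The mean of `h` over the sphere of radius `r`. -/
noncomputable def sphereMean (h : V → ℂ) (r : ℝ) : ℂ :=
  ∫ ω : sphere (0 : V) 1, h (r • (ω : V)) ∂sphereProb V

theorem norm_sphereMean_le [Nontrivial V] {h : V → ℂ} {C : ℝ} (hC : ∀ x, ‖h x‖ ≤ C) (r : ℝ) :
    ‖sphereMean h r‖ ≤ C := by
  simpa [sphereMean] using norm_integral_le_of_norm_le_const (μ := sphereProb V)
    (f := fun ω : sphere (0 : V) 1 => h (r • (ω : V))) (.of_forall fun ω => hC _)

theorem continuous_sphereMean [Nontrivial V] {h : V → ℂ} (hh : Continuous h) {C : ℝ}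
    (hC : ∀ x, ‖h x‖ ≤ C) : Continuous (sphereMean h) :=
  continuous_of_dominated (bound := fun _ => C)
    (fun r => (by fun_prop : Continuous fun ω : sphere (0 : V) 1 =>
      h (r • (ω : V))).aestronglyMeasurable)
    (fun r => .of_forall fun ω => hC _) (integrable_const C) (.of_forall fun ω => by fun_prop)

/-- Against a radial density, a bounded continuous function may be replaced by its means over
spheres. -/
theorem integral_radial_mul [Nontrivial V] {F h : V → ℂ} (hF : Integrable F)
    (hrad : ∀ x y, ‖x‖ = ‖y‖ → F x = F y) (hh : Continuous h) {C : ℝ} (hC : ∀ x, ‖h x‖ ≤ C) :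
    ∫ ξ, F ξ * h ξ = ∫ ξ, F ξ * sphereMean h ‖ξ‖ := by
  have i1 : Integrable fun ξ => F ξ * h ξ :=
    hF.mul_bdd hh.aestronglyMeasurable (.of_forall hC)
  have i2 : Integrable fun ξ : V => F ξ * sphereMean h ‖ξ‖ :=
    hF.mul_bdd ((continuous_sphereMean hh hC).comp continuous_norm).aestronglyMeasurable
      (.of_forall fun ξ => norm_sphereMean_le hC _)
  rw [integral_polar i1, integral_polar i2]
  congr with r
  obtain ⟨ω₀⟩ : Nonempty (sphere (0 : V) 1) :=
    (NormedSpace.sphere_nonempty.2 zero_le_one).to_subtype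
  have e : ∀ ω : sphere (0 : V) 1, F ((r : ℝ) • (ω : V)) = F ((r : ℝ) • (ω₀ : V)) :=
    fun ω => hrad _ _ (by simp [norm_smul])
  have e2 : ∀ ω : sphere (0 : V) 1, ‖(r : ℝ) • (ω : V)‖ = r := fun ω => by
    simp [norm_smul, abs_of_pos r.2.out]
  simp only [e, e2]
  rw [toSphere_eq_smul_sphereProb, integral_smul_measure, integral_smul_measure,
    integral_const_mul, integral_const]
  simp [sphereMean]

/-- A rapidly decaying profile centred anywhere has mean `O((1 + r)^{-(n-1)})` over the sphere of
radius `r`: up to constants it dominates its values on the shell of radii in `(r + 1, r + 2)`,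
whose volume element is at least `(1 + r)^{n-1}`. -/
theorem exists_lintegral_sphere_decay [Nontrivial V] : ∃ C : ℝ≥0, ∀ (r : ℝ), 0 ≤ r → ∀ η : V,
    ∫⁻ ω : sphere (0 : V) 1,
      ENNReal.ofReal ((1 + ‖r • (ω : V) - η‖) ^ (-(Module.finrank ℝ V + 1 : ℝ))) ∂sphereProb V
      ≤ C * ENNReal.ofReal ((1 + r) ^ (-(Module.finrank ℝ V - 1 : ℝ))) := by
  set M : ℝ := Module.finrank ℝ V + 1 with hM
  have hMpos : 0 < M := by positivity
  set I : ℝ≥0∞ := ∫⁻ x : V, ENNReal.ofReal ((1 + ‖x‖) ^ (-M)) with hI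
  have hIfin : I < ⊤ := finite_integral_one_add_norm (by rw [hM]; linarith)
  set c : ℝ≥0∞ := (volume : Measure V).toSphere univ with hc
  have hc0 : c ≠ 0 := measure_univ_ne_zero.2 (toSphere_ne_zero volume)
  have hctop : c ≠ ⊤ := measure_ne_top _ _
  refine ⟨(c⁻¹ * (ENNReal.ofReal (3 ^ M) * I)).toNNReal, fun r hr η => ?_⟩
  rw [ENNReal.coe_toNNReal (ENNReal.mul_ne_top (ENNReal.inv_ne_top.2 hc0)
    (ENNReal.mul_ne_top ENNReal.ofReal_ne_top hIfin.ne))]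
  have hn : (Module.finrank ℝ V : ℝ) - 1 = ((Module.finrank ℝ V - 1 : ℕ) : ℝ) := by
    rw [Nat.cast_sub Module.finrank_pos]; simp
  set n := Module.finrank ℝ V - 1 with hn'
  set J := ∫⁻ ω : sphere (0 : V) 1,
      ENNReal.ofReal ((1 + ‖r • (ω : V) - η‖) ^ (-M)) ∂(volume : Measure V).toSphere with hJ
  have key : ENNReal.ofReal ((1 + r) ^ n) * (ENNReal.ofReal (3 ^ (-M)) * J) ≤ I := by
    have e1 : I = ∫⁻ x : V, ENNReal.ofReal ((1 + ‖x - η‖) ^ (-M)) :=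
      (lintegral_sub_right_eq_self (fun x : V => ENNReal.ofReal ((1 + ‖x‖) ^ (-M))) η).symm
    rw [e1, lintegral_polar (by fun_prop)]
    calc ENNReal.ofReal ((1 + r) ^ n) * (ENNReal.ofReal (3 ^ (-M)) * J)
        = ∫⁻ ρ in Ioo (r + 1) (r + 2),
          ENNReal.ofReal ((1 + r) ^ n) * (ENNReal.ofReal (3 ^ (-M)) * J) := by
          rw [lintegral_const]; simp; norm_num
      _ ≤ ∫⁻ ρ in Ioo (r + 1) (r + 2), ENNReal.ofReal (ρ ^ n) *
          ∫⁻ ω : sphere (0 : V) 1, ENNReal.ofReal ((1 + ‖ρ • (ω : V) - η‖) ^ (-M))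
            ∂(volume : Measure V).toSphere := by
          refine setLIntegral_mono' measurableSet_Ioo fun ρ hρ => ?_
          gcongr
          · linarith [hρ.1]
          · rw [hJ, ← lintegral_const_mul _ (by fun_prop)]
            refine lintegral_mono fun ω => ?_
            rw [← ENNReal.ofReal_mul (by positivity), ← Real.mul_rpow (by norm_num) (by positivity)]
            refine ENNReal.ofReal_le_ofReal
              (Real.rpow_le_rpow_of_nonpos (by positivity) ?_ (by linarith))
            have h1 : ‖ρ • (ω : V) - r • (ω : V)‖ ≤ 2 := by
              rw [← sub_smul, norm_smul]
              have : ‖(ω : V)‖ = 1 := by simp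
              rw [this, mul_one, Real.norm_eq_abs, abs_of_pos (by linarith [hρ.1])]
              linarith [hρ.2]
            have h2 : ‖ρ • (ω : V) - η‖ ≤
                ‖ρ • (ω : V) - r • (ω : V)‖ + ‖r • (ω : V) - η‖ :=
              norm_sub_le_norm_sub_add_norm_sub _ _ _
            linarith [norm_nonneg (r • (ω : V) - η)]
      _ ≤ _ := lintegral_mono_set fun ρ hρ => by
          have := hρ.1
          simp only [mem_Ioi]; linarith
  have e2 : ∫⁻ ω : sphere (0 : V) 1,
      ENNReal.ofReal ((1 + ‖r • (ω : V) - η‖) ^ (-M)) ∂sphereProb V = c⁻¹ * J := by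
    rw [sphereProb, lintegral_smul_measure, smul_eq_mul]
  rw [e2, mul_assoc]
  gcongr
  have p1 : ENNReal.ofReal ((1 + r) ^ (-(Module.finrank ℝ V - 1 : ℝ))) *
      ENNReal.ofReal ((1 + r) ^ n) = 1 := by
    rw [← ENNReal.ofReal_mul (by positivity), hn, ← Real.rpow_natCast (1 + r) n,
      ← Real.rpow_add (by positivity)]
    simp
  have p2 : ENNReal.ofReal (3 ^ M) * ENNReal.ofReal (3 ^ (-M)) = 1 := by
    rw [← ENNReal.ofReal_mul (by positivity), ← Real.rpow_add (by positivity)]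
    simp
  calc J = (ENNReal.ofReal (3 ^ M) * ENNReal.ofReal (3 ^ (-M))) *
        (ENNReal.ofReal ((1 + r) ^ (-(Module.finrank ℝ V - 1 : ℝ))) *
          ENNReal.ofReal ((1 + r) ^ n)) * J := by rw [p1, p2]; simp
    _ = ENNReal.ofReal (3 ^ M) * (ENNReal.ofReal ((1 + r) ^ n) * (ENNReal.ofReal (3 ^ (-M)) * J)) *
        ENNReal.ofReal ((1 + r) ^ (-(Module.finrank ℝ V - 1 : ℝ))) := by ring
    _ ≤ _ := by gcongr

end Polar

/-! ### Spherical waves -/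

section SphericalWave

variable {V : Type*} [NormedAddCommGroup V] [InnerProductSpace ℝ V]

theorem SchwartzMap.exists_norm_le_one_add_rpow (f : SchwartzMap V ℂ) (k : ℕ) :
    ∃ C : ℝ≥0, ∀ x, ‖f x‖ₑ ≤ C * ENNReal.ofReal ((1 + ‖x‖) ^ (-(k : ℝ))) := by
  have h := SchwartzMap.one_add_le_sup_seminorm_apply (𝕜 := ℂ) (m := (k, 0)) le_rfl le_rfl f
  set D := 2 ^ k * ((Finset.Iic ((k, 0) : ℕ × ℕ)).sup
    fun m => SchwartzMap.seminorm ℂ m.1 m.2) f with hD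
  refine ⟨D.toNNReal, fun x => ?_⟩
  have hx := h x
  simp only [norm_iteratedFDeriv_zero] at hx
  have hp : (0 : ℝ) < (1 + ‖x‖) ^ k := by positivity
  have hD0 : 0 ≤ D := le_trans (by positivity) hx
  rw [← ofReal_norm, show ((D.toNNReal : ℝ≥0) : ℝ≥0∞) = ENNReal.ofReal D from rfl,
    ← ENNReal.ofReal_mul hD0, Real.rpow_neg (by positivity), Real.rpow_natCast]
  refine ENNReal.ofReal_le_ofReal ?_
  rw [← div_eq_mul_inv, le_div_iff₀ hp]
  linarith

variable [FiniteDimensional ℝ V] [MeasurableSpace V] [BorelSpace V]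

open Set Metric

/-- The radial plane wave of frequency `r`: the mean of `y ↦ e^{2πi⟪y, ξ⟫}` over `‖ξ‖ = r`. -/
noncomputable def sphericalWave (r : ℝ) (y : V) : ℂ :=
  sphereMean (fun ξ : V => (Real.fourierChar (inner ℝ y ξ) : ℂ)) r

theorem norm_sphericalWave_le [Nontrivial V] (r : ℝ) (y : V) : ‖sphericalWave r y‖ ≤ 1 :=
  norm_sphereMean_le (fun _ => (Circle.norm_coe _).le) r

theorem continuous_sphericalWave [Nontrivial V] :
    Continuous fun p : ℝ × V => sphericalWave p.1 p.2 :=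
  continuous_of_dominated (bound := fun _ => 1)
    (fun p => (by fun_prop : Continuous fun ω : sphere (0 : V) 1 =>
      (Real.fourierChar (inner ℝ p.2 (p.1 • (ω : V))) : ℂ)).aestronglyMeasurable)
    (fun p => .of_forall fun ω => (Circle.norm_coe _).le) (integrable_const 1)
    (.of_forall fun ω => by fun_prop)

theorem fourierInv_eq_integral_mul (f : V → ℂ) (ξ : V) :
    𝓕⁻ f ξ = ∫ y, f y * (Real.fourierChar (inner ℝ y ξ) : ℂ) := by
  rw [Real.fourierInv_eq]
  congr with y
  rw [Circle.smul_def, smul_eq_mul, mul_comm]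

/-- Pairing with a spherical wave takes the spherical mean of the Fourier transform. -/
theorem integral_mul_sphericalWave [Nontrivial V] {f : V → ℂ} (hf : Integrable f) (r : ℝ) :
    ∫ y, f y * sphericalWave r y = sphereMean (𝓕⁻ f) r := by
  simp only [sphericalWave, sphereMean, fourierInv_eq_integral_mul, ← integral_const_mul]
  rw [integral_integral_swap]
  refine (hf.comp_fst (sphereProb V)).mul_bdd (c := 1) ?_
    (.of_forall fun p => (Circle.norm_coe _).le)
  exact (by fun_prop : Continuous fun p : V × sphere (0 : V) 1 =>
    (Real.fourierChar (inner ℝ p.1 (r • (p.2 : V))) : ℂ)).aestronglyMeasurable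

/-- **Decay of spherical waves in `L²`.** Expanding the square turns the integral into a double
mean over the sphere of the Fourier transform of `χ²`, which decays rapidly. -/
theorem exists_lintegral_sq_sphericalWave_le [Nontrivial V] {χ : V → ℝ}
    (hχ : ContDiff ℝ ((⊤ : ℕ∞) : WithTop ℕ∞) χ) (hc : HasCompactSupport χ) :
    ∃ C : ℝ≥0, ∀ r : ℝ, 0 ≤ r → ∫⁻ y, ‖(χ y : ℂ) * sphericalWave r y‖ₑ ^ 2 ≤
      C * ENNReal.ofReal ((1 + r) ^ (-(Module.finrank ℝ V - 1 : ℝ))) := by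
  have hs1 : HasCompactSupport fun y => ((χ y ^ 2 : ℝ) : ℂ) :=
    hc.comp_left (g := fun s : ℝ => ((s ^ 2 : ℝ) : ℂ)) (by simp)
  have hs2 : ContDiff ℝ ((⊤ : ℕ∞) : WithTop ℕ∞) fun y => ((χ y ^ 2 : ℝ) : ℂ) :=
    Complex.ofRealCLM.contDiff.comp (hχ.pow 2)
  set Ψ : SchwartzMap V ℂ := hs1.toSchwartzMap hs2 with hΨ
  have hΨa : ∀ y, Ψ y = ((χ y ^ 2 : ℝ) : ℂ) := fun y => rfl
  obtain ⟨C₁, hC₁⟩ := (𝓕⁻ Ψ).exists_norm_le_one_add_rpow (Module.finrank ℝ V + 1)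
  obtain ⟨C₂, hC₂⟩ := exists_lintegral_sphere_decay (V := V)
  refine ⟨C₁ * C₂, fun r hr => ?_⟩
  set w : V → ℂ := sphericalWave r with hw
  have hwc : Continuous w := continuous_sphericalWave.comp
    (by fun_prop : Continuous fun y : V => (r, y))
  set B := ((C₁ * C₂ : ℝ≥0) : ℝ≥0∞) * ENNReal.ofReal ((1 + r) ^ (-(Module.finrank ℝ V - 1 : ℝ)))
    with hB
  have hint : Integrable fun y => Ψ y * (starRingEnd ℂ) (w y) :=
    Ψ.integrable.mul_bdd (c := 1) (by fun_prop) (.of_forall fun y => by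
      simpa using norm_sphericalWave_le r y)
  -- the one-sided mean of the transform of `χ²`, centred at an arbitrary point
  have hone : ∀ η : V, ‖𝓕⁻ (fun y => Ψ y * (starRingEnd ℂ) (w y)) η‖ₑ ≤ B := fun η => by
    have hi : Integrable fun y => Ψ y * (Real.fourierChar (inner ℝ y (-η)) : ℂ) :=
      Ψ.integrable.mul_bdd (c := 1)
        (by fun_prop : Continuous fun y : V =>
          (Real.fourierChar (inner ℝ y (-η)) : ℂ)).aestronglyMeasurable
        (.of_forall fun y => (Circle.norm_coe _).le)
    have e1 : 𝓕⁻ (fun y => Ψ y * (starRingEnd ℂ) (w y)) η =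
        (starRingEnd ℂ) (∫ y, (Ψ y * (Real.fourierChar (inner ℝ y (-η)) : ℂ)) * w y) := by
      rw [fourierInv_eq_integral_mul, ← integral_conj]
      congr with y
      simp only [map_mul, hΨa, Complex.conj_ofReal, inner_neg_right]
      rw [AddChar.map_neg_eq_inv, Circle.coe_inv_eq_conj, Complex.conj_conj]
      ring
    have e2 : ∀ ξ, 𝓕⁻ (fun y => Ψ y * (Real.fourierChar (inner ℝ y (-η)) : ℂ)) ξ =
        (𝓕⁻ Ψ : SchwartzMap V ℂ) (ξ - η) := fun ξ => by
      rw [SchwartzMap.fourierInv_coe, fourierInv_eq_integral_mul, fourierInv_eq_integral_mul]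
      congr with y
      rw [sub_eq_neg_add, inner_add_right, AddChar.map_add_eq_mul, Circle.coe_mul, mul_assoc]
    rw [e1, RCLike.enorm_conj, hw, integral_mul_sphericalWave hi]
    refine (enorm_integral_le_lintegral_enorm _).trans ?_
    calc _ ≤ ∫⁻ ω : sphere (0 : V) 1, C₁ *
          ENNReal.ofReal ((1 + ‖r • (ω : V) - η‖) ^ (-(Module.finrank ℝ V + 1 : ℝ)))
          ∂sphereProb V := by
          refine lintegral_mono fun ω => ?_
          rw [e2]
          simpa using hC₁ (r • (ω : V) - η)
      _ ≤ B := by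
          rw [lintegral_const_mul _ (by fun_prop), hB, ENNReal.coe_mul, mul_assoc]
          gcongr
          exact hC₂ r hr η
  have e3 : ∫⁻ y, ‖(χ y : ℂ) * w y‖ₑ ^ 2 = ‖∫ y, (Ψ y * (starRingEnd ℂ) (w y)) * w y‖ₑ := by
    have e4 : ∀ y, (Ψ y * (starRingEnd ℂ) (w y)) * w y = ((‖(χ y : ℂ) * w y‖ ^ 2 : ℝ) : ℂ) :=
      fun y => by
        rw [mul_assoc, mul_comm ((starRingEnd ℂ) (w y)), Complex.mul_conj, hΨa, norm_mul, mul_pow,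
          Complex.normSq_eq_norm_sq]
        simp
    have i4 : Integrable fun y => ‖(χ y : ℂ) * w y‖ ^ 2 := by
      have : Integrable fun y => (Ψ y * (starRingEnd ℂ) (w y)) * w y :=
        hint.mul_bdd (c := 1) hwc.aestronglyMeasurable
          (.of_forall fun y => norm_sphericalWave_le r y)
      simpa [e4] using this.norm
    simp only [e4]
    rw [integral_complex_ofReal, ← ofReal_norm, Complex.norm_real, Real.norm_of_nonneg
      (integral_nonneg fun y => by positivity), ofReal_integral_eq_lintegral_ofReal i4
        (.of_forall fun y => by positivity)]
    congr with y
    rw [← ofReal_norm, ENNReal.ofReal_pow (norm_nonneg _)]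
  rw [e3, hw, integral_mul_sphericalWave hint]
  refine (enorm_integral_le_lintegral_enorm _).trans ((lintegral_mono fun ω => hone _).trans ?_)
  simp

/-- The `L¹` counterpart of `exists_lintegral_sq_sphericalWave_le`, with the square root of the
decay. -/
theorem exists_lintegral_sphericalWave_le [Nontrivial V] {χ : V → ℝ}
    (hχ : ContDiff ℝ ((⊤ : ℕ∞) : WithTop ℕ∞) χ) (hc : HasCompactSupport χ) :
    ∃ C : ℝ≥0, ∀ r : ℝ, 0 ≤ r → ∫⁻ y, ‖(χ y : ℂ) * sphericalWave r y‖ₑ ≤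
      C * ENNReal.ofReal ((1 + r) ^ (-((Module.finrank ℝ V - 1 : ℝ) / 2))) := by
  obtain ⟨C, hC⟩ := exists_lintegral_sq_sphericalWave_le hχ hc
  have hK : volume (tsupport χ) < ⊤ := hc.isCompact.measure_lt_top
  refine ⟨(volume (tsupport χ)).toNNReal + C, fun r hr => ?_⟩
  set l : ℝ := (1 + r) ^ (-((Module.finrank ℝ V - 1 : ℝ) / 2)) with hl
  have hl0 : 0 < l := by positivity
  -- `a ≤ l + a² / l`, with `l²` the rate of the `L²` bound, replaces the Cauchy-Schwarz inequality
  have hpt : ∀ y, ‖(χ y : ℂ) * sphericalWave r y‖ₑ ≤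
      (tsupport χ).indicator (fun _ => ENNReal.ofReal l) y +
        ENNReal.ofReal l⁻¹ * ‖(χ y : ℂ) * sphericalWave r y‖ₑ ^ 2 := fun y => by
    by_cases hy : y ∈ tsupport χ
    · rw [indicator_of_mem hy, ← ofReal_norm, ← ENNReal.ofReal_pow (norm_nonneg _),
        ← ENNReal.ofReal_mul (by positivity), ← ENNReal.ofReal_add hl0.le (by positivity)]
      refine ENNReal.ofReal_le_ofReal ?_
      set a := ‖(χ y : ℂ) * sphericalWave r y‖
      rcases le_total a l with h | h
      · have : 0 ≤ l⁻¹ * a ^ 2 := by positivity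
        linarith
      · have : a ≤ l⁻¹ * a ^ 2 := by
          rw [inv_mul_eq_div, le_div_iff₀ hl0]
          nlinarith
        linarith
    · simp [image_eq_zero_of_notMem_tsupport hy]
  refine (lintegral_mono hpt).trans ?_
  rw [lintegral_add_left (measurable_const.indicator (isClosed_tsupport χ).measurableSet),
    lintegral_indicator_const (isClosed_tsupport χ).measurableSet,
    lintegral_const_mul' _ _ ENNReal.ofReal_ne_top, ENNReal.coe_add, add_mul,
    ENNReal.coe_toNNReal hK.ne, mul_comm (volume _)]
  refine add_le_add le_rfl ?_
  refine (mul_le_mul_right (hC r hr) _).trans (le_of_eq ?_)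
  rw [mul_left_comm, ← ENNReal.ofReal_mul (by positivity)]
  congr 2
  rw [hl, ← Real.rpow_neg (by positivity), ← Real.rpow_add (by positivity)]
  congr 1; ring

end SphericalWave

/-! ### Dispersive decay of wave packets -/

section Multiplier

variable {V : Type*} [NormedAddCommGroup V] [InnerProductSpace ℝ V]

/-- The function `η ↦ e^{-b|η|²} e^{2πi⟪η, x⟫}`; for `b = 4π²it` it is the kernel through which
`e^{itΔ} g x` is read off from `ĝ`, for `Re b > 0` it is a Gaussian. -/
noncomputable def gaussianWave (b : ℂ) (x η : V) : ℂ :=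
  Complex.exp (-b * ‖η‖ ^ 2) * (Real.fourierChar (inner ℝ η x) : ℂ)

theorem continuous_gaussianWave (b : ℂ) (x : V) : Continuous (gaussianWave b x) := by
  unfold gaussianWave; fun_prop

theorem norm_gaussianWave_le {b : ℂ} (hb : 0 ≤ b.re) (x η : V) : ‖gaussianWave b x η‖ ≤ 1 := by
  rw [gaussianWave, norm_mul, Circle.norm_coe, mul_one, Complex.norm_exp, Real.exp_le_one_iff]
  have : (-b * (‖η‖ : ℂ) ^ 2).re = -(b.re * ‖η‖ ^ 2) := by
    rw [← Complex.ofReal_pow, Complex.re_mul_ofReal]; simp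
  rw [this]
  have : 0 ≤ b.re * ‖η‖ ^ 2 := by positivity
  linarith

theorem gaussianWave_eq (b : ℂ) (x : V) : gaussianWave b x = fun η =>
    Complex.exp (-b * ‖η‖ ^ 2 + 2 * Real.pi * Complex.I * inner ℝ x η) := by
  ext η
  rw [gaussianWave, Real.fourierChar_apply, ← Complex.exp_add, real_inner_comm]
  congr 2
  push_cast
  ring

variable [FiniteDimensional ℝ V] [MeasurableSpace V] [BorelSpace V]

theorem fourier_eq_integral_mul (f : V → ℂ) (ξ : V) :
    𝓕 f ξ = ∫ y, f y * (Real.fourierChar (-inner ℝ y ξ) : ℂ) := by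
  rw [Real.fourier_eq]
  congr with y
  rw [Circle.smul_def, smul_eq_mul, mul_comm]

theorem integral_fourier_mul_eq {f g : V → ℂ} (hf : Integrable f) (hg : Integrable g) :
    ∫ ξ, 𝓕 f ξ * g ξ = ∫ x, f x * 𝓕 g x := by
  have h := VectorFourier.integral_fourierIntegral_smul_eq_flip (𝕜 := ℝ) (L := innerₗ V)
    (μ := volume) (ν := volume) (f := f) (g := g) Real.continuous_fourierChar
    continuous_inner hf hg
  rw [flip_innerₗ] at h
  exact h

/-- If `χ = 1` where `g ≠ 0`, then `ĝ = ĝ ⋆ χ̂`. -/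
theorem fourier_eq_integral_fourier_mul {g χ : V → ℂ} (hg : Continuous g) (hgi : Integrable g)
    (hĝ : Integrable (𝓕 g)) (hχ : Integrable χ) (hχg : ∀ y, χ y * g y = g y) (η : V) :
    𝓕 g η = ∫ ξ, 𝓕 g ξ * 𝓕 χ (η - ξ) := by
  have hi : Integrable fun y => χ y * (Real.fourierChar (-inner ℝ y η) : ℂ) :=
    hχ.mul_bdd (c := 1) (by fun_prop : Continuous fun y : V =>
      (Real.fourierChar (-inner ℝ y η) : ℂ)).aestronglyMeasurable
      (.of_forall fun y => (Circle.norm_coe _).le)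
  have h := integral_mul_fourierInv_eq hi hĝ
  rw [hg.fourierInv_fourier_eq hgi hĝ] at h
  calc 𝓕 g η = ∫ y, χ y * (Real.fourierChar (-inner ℝ y η) : ℂ) * g y := by
        rw [fourier_eq_integral_mul]
        congr with y
        conv_lhs => rw [← hχg y]
        ring
    _ = _ := by
        rw [h]
        congr with ξ
        rw [mul_comm, fourierInv_eq_integral_mul, fourier_eq_integral_mul χ]
        congr with y
        rw [mul_assoc, ← Circle.coe_mul, ← AddChar.map_add_eq_mul, inner_sub_right]
        ring_nf

/-- If `G = G ⋆ k`, then integrating `G` against `m` amounts to testing `m` against the translates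
of `k`, weighted by `G`. -/
theorem integral_conv_mul_eq {G k m : V → ℂ} (hG : Integrable G) (hk : Integrable k)
    (hm : Continuous m) (hm1 : ∀ η, ‖m η‖ ≤ 1) (hconv : ∀ η, G η = ∫ ξ, G ξ * k (η - ξ)) :
    ∫ η, G η * m η = ∫ ξ, G ξ * ∫ η, k η * m (η + ξ) := by
  have hi : Integrable (fun p : V × V => G p.2 * k (p.1 - p.2)) (volume.prod volume) :=
    hG.convolution_integrand (ContinuousLinearMap.mul ℂ ℂ) hk
  calc ∫ η, G η * m η = ∫ η, ∫ ξ, G ξ * k (η - ξ) * m η := by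
        congr with η
        rw [integral_mul_const, ← hconv]
    _ = ∫ ξ, ∫ η, G ξ * k (η - ξ) * m η :=
        integral_integral_swap (hi.mul_bdd (c := 1)
          (hm.comp continuous_fst).aestronglyMeasurable (.of_forall fun p => hm1 _))
    _ = _ := by
        congr with ξ
        rw [← integral_const_mul]
        rw [← integral_add_right_eq_self _ ξ]
        simp [mul_assoc]

theorem integrable_gaussianWave {b : ℂ} (hb : 0 < b.re) (x : V) :
    Integrable (gaussianWave b x) := by
  rw [gaussianWave_eq]
  exact GaussianFourier.integrable_cexp_neg_mul_sq_norm_add hb _ x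

theorem norm_fourier_gaussianWave_le {b : ℂ} (hb : 0 < b.re) (x y : V) :
    ‖𝓕 (gaussianWave b x) y‖ ≤ (Real.pi / ‖b‖) ^ ((Module.finrank ℝ V : ℝ) / 2) := by
  have hb0 : b ≠ 0 := fun h => by simp [h] at hb
  have hn : 0 < ‖b‖ := norm_pos_iff.2 hb0
  rw [gaussianWave_eq, fourier_gaussian_innerProductSpace' hb, norm_mul]
  have e1 : ((Module.finrank ℝ V : ℂ) / 2) = (((Module.finrank ℝ V : ℝ) / 2 : ℝ) : ℂ) := by
    push_cast; ring
  have e2 : ‖((Real.pi : ℂ) / b) ^ ((Module.finrank ℝ V : ℂ) / 2)‖ =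
      (Real.pi / ‖b‖) ^ ((Module.finrank ℝ V : ℝ) / 2) := by
    rw [e1, Complex.norm_cpow_real, norm_div, Complex.norm_real,
      Real.norm_of_nonneg Real.pi_pos.le]
  rw [e2]
  refine mul_le_of_le_one_right (by positivity) ?_
  rw [Complex.norm_exp, Real.exp_le_one_iff]
  have e3 : (-(Real.pi : ℂ) ^ 2 * (‖x - y‖ : ℂ) ^ 2 / b) =
      ((-(Real.pi ^ 2 * ‖x - y‖ ^ 2) : ℝ) : ℂ) * b⁻¹ := by
    push_cast; ring
  rw [e3, Complex.re_ofReal_mul, Complex.inv_re]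
  have : 0 ≤ Real.pi ^ 2 * ‖x - y‖ ^ 2 * (b.re / Complex.normSq b) := by
    have := Complex.normSq_nonneg b
    positivity
  linarith

/-- With `k = χ̂`, the function `gaussianWave b x` tested against the `ξ`-translate of `k`; for
`b = 4π²it` this is the Schrödinger evolution of `χ e^{2πi⟪ξ, ·⟫}`, evaluated at `x`. -/
noncomputable def packetFlow (k : V → ℂ) (b : ℂ) (x ξ : V) : ℂ :=
  ∫ η, k η * gaussianWave b x (η + ξ)

theorem norm_packetFlow_le {k : V → ℂ} (hk : Integrable k) {b : ℂ} (hb : 0 ≤ b.re) (x ξ : V) :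
    ‖packetFlow k b x ξ‖ ≤ ∫ η, ‖k η‖ := by
  refine norm_integral_le_of_norm_le hk.norm (.of_forall fun η => ?_)
  rw [norm_mul]
  exact mul_le_of_le_one_right (norm_nonneg _) (norm_gaussianWave_le hb _ _)

theorem continuous_packetFlow {k : V → ℂ} (hk : Integrable k) {b : ℂ} (hb : 0 ≤ b.re) (x : V) :
    Continuous (packetFlow k b x) := by
  have hc := continuous_gaussianWave b x
  refine continuous_of_dominated (bound := fun η => ‖k η‖)
    (fun ξ => hk.1.mul
      (by fun_prop : Continuous fun η => gaussianWave b x (η + ξ)).aestronglyMeasurable)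
    (fun ξ => .of_forall fun η => ?_) hk.norm (.of_forall fun η => by fun_prop)
  rw [norm_mul]
  exact mul_le_of_le_one_right (norm_nonneg _) (norm_gaussianWave_le hb _ _)

/-- For `Re b > 0` the packet is a Gaussian convolution on the physical side. -/
theorem packetFlow_fourier_eq {χ : V → ℂ} (hχ : Integrable χ) {b : ℂ} (hb : 0 < b.re) (x : V) :
    packetFlow (𝓕 χ) b x = 𝓕⁻ fun y => χ y * 𝓕 (gaussianWave b x) y := by
  ext ξ
  have h := integral_fourier_mul_eq hχ ((integrable_gaussianWave hb x).comp_add_right ξ)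
  rw [packetFlow, h, fourierInv_eq_integral_mul]
  congr with y
  rw [mul_assoc, fourier_eq_integral_mul, fourier_eq_integral_mul]
  congr 1
  rw [← integral_mul_const]
  conv_rhs => rw [← integral_add_right_eq_self _ ξ]
  congr with η
  rw [mul_assoc, ← Circle.coe_mul, ← AddChar.map_add_eq_mul, inner_add_left,
    real_inner_comm ξ y]
  ring_nf

theorem norm_sphereMean_packetFlow_le_of_pos [Nontrivial V] {χ : V → ℂ} (hχ : Integrable χ) {b : ℂ}
    (hb : 0 < b.re) (x : V) (r : ℝ) :
    ‖sphereMean (packetFlow (𝓕 χ) b x) r‖ ≤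
      (Real.pi / ‖b‖) ^ ((Module.finrank ℝ V : ℝ) / 2) * ∫ y, ‖χ y * sphericalWave r y‖ := by
  have hcw : Continuous (sphericalWave r : V → ℂ) :=
    continuous_sphericalWave.comp (by fun_prop : Continuous fun y : V => (r, y))
  have hc : Continuous (𝓕 (gaussianWave b x)) :=
    continuous_fourier_of_integrable (integrable_gaussianWave hb x)
  have hi : Integrable fun y => χ y * 𝓕 (gaussianWave b x) y :=
    hχ.mul_bdd hc.aestronglyMeasurable (.of_forall fun y => norm_fourier_gaussianWave_le hb x y)
  have hi2 : Integrable fun y => χ y * sphericalWave r y :=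
    hχ.mul_bdd hcw.aestronglyMeasurable (.of_forall fun y => norm_sphericalWave_le r y)
  rw [packetFlow_fourier_eq hχ hb, ← integral_mul_sphericalWave hi, ← integral_const_mul]
  refine norm_integral_le_of_norm_le (hi2.norm.const_mul _) (.of_forall fun y => ?_)
  rw [mul_right_comm, norm_mul, mul_comm]
  gcongr
  exact norm_fourier_gaussianWave_le hb x y

/-- **Dispersive estimate** for spherical packets, including the oscillatory case `Re b = 0`, which
is a limit of Gaussian ones. -/
theorem norm_sphereMean_packetFlow_le [Nontrivial V] {χ : V → ℂ} (hχ : Integrable χ)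
    (hχ' : Integrable (𝓕 χ)) {b : ℂ} (hb : 0 ≤ b.re) (hb0 : b ≠ 0) (x : V) (r : ℝ) :
    ‖sphereMean (packetFlow (𝓕 χ) b x) r‖ ≤
      (Real.pi / ‖b‖) ^ ((Module.finrank ℝ V : ℝ) / 2) * ∫ y, ‖χ y * sphericalWave r y‖ := by
  set c : ℕ → ℂ := fun j => b + ((1 / ((j : ℝ) + 1) : ℝ) : ℂ) with hcdef
  have hre : ∀ j, 0 < (c j).re := fun j => by
    have : (0 : ℝ) < 1 / ((j : ℝ) + 1) := by positivity
    simp only [hcdef, Complex.add_re, Complex.ofReal_re]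
    linarith
  have hlim : Filter.Tendsto c Filter.atTop (nhds b) := by
    have h := (Complex.continuous_ofReal.tendsto 0).comp
      (tendsto_one_div_add_atTop_nhds_zero_nat (𝕜 := ℝ))
    simpa [hcdef] using h.const_add b
  have hwave : ∀ η : V, Filter.Tendsto (fun j => gaussianWave (c j) x η) Filter.atTop
      (nhds (gaussianWave b x η)) := fun η => by
    have : Continuous fun z : ℂ => gaussianWave z x η := by unfold gaussianWave; fun_prop
    exact (this.tendsto b).comp hlim
  have hpk : ∀ ξ : V, Filter.Tendsto (fun j => packetFlow (𝓕 χ) (c j) x ξ) Filter.atTop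
      (nhds (packetFlow (𝓕 χ) b x ξ)) := fun ξ => by
    refine tendsto_integral_of_dominated_convergence (fun η => ‖𝓕 χ η‖) (fun j => ?_) hχ'.norm
      (fun j => .of_forall fun η => ?_) (.of_forall fun η => (hwave _).const_mul _)
    · have hc := continuous_gaussianWave (c j) x
      exact hχ'.1.mul
        (by fun_prop : Continuous fun η => gaussianWave (c j) x (η + ξ)).aestronglyMeasurable
    · rw [norm_mul]
      exact mul_le_of_le_one_right (norm_nonneg _) (norm_gaussianWave_le (hre j).le _ _)
  have hmean : Filter.Tendsto (fun j => sphereMean (packetFlow (𝓕 χ) (c j) x) r) Filter.atTop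
      (nhds (sphereMean (packetFlow (𝓕 χ) b x) r)) := by
    refine tendsto_integral_of_dominated_convergence (fun _ => ∫ η, ‖𝓕 χ η‖) (fun j => ?_)
      (integrable_const _) (fun j => .of_forall fun ω => norm_packetFlow_le hχ' (hre j).le _ _)
      (.of_forall fun ω => hpk _)
    have hc := continuous_packetFlow hχ' (hre j).le x
    exact (by fun_prop : Continuous fun ω : Metric.sphere (0 : V) 1 =>
      packetFlow (𝓕 χ) (c j) x (r • (ω : V))).aestronglyMeasurable
  refine le_of_tendsto_of_tendsto hmean.norm (Filter.Tendsto.mul_const _ ?_)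
    (.of_forall fun j => norm_sphereMean_packetFlow_le_of_pos hχ (hre j) x r)
  exact ((tendsto_const_nhds.div hlim.norm (norm_ne_zero_iff.2 hb0)).rpow_const
    (Or.inr (by positivity)))

end Multiplier

/-! ### Radial functions supported in the unit ball -/

section Flow

/-- Minkowski's integral inequality in `L²`, for a kernel whose sections `K x` have `L²` norm at
most `√C w x`. -/
theorem lintegral_sq_lintegral_mul_le {X Y : Type*} [MeasurableSpace X] [MeasurableSpace Y]
    {μ : Measure X} {ν : Measure Y} [SFinite μ] [SFinite ν] {G w : X → ℝ≥0∞}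
    {K : X → Y → ℝ≥0∞} (hG : Measurable G) (hw : Measurable w)
    (hK : Measurable (Function.uncurry K)) (hw0 : ∀ x, w x ≠ 0) (hwt : ∀ x, w x ≠ ⊤) {C : ℝ≥0∞}
    (hC : ∀ x, ∫⁻ y, K x y ^ 2 ∂ν ≤ C * w x ^ 2) :
    ∫⁻ y, (∫⁻ x, G x * K x y ∂μ) ^ 2 ∂ν ≤ C * (∫⁻ x, G x * w x ∂μ) ^ 2 := by
  have hKy : ∀ y, Measurable fun x => K x y := fun y =>
    hK.comp (measurable_id.prodMk measurable_const)
  have hKx : ∀ x, Measurable (K x) := fun x => hK.comp (measurable_const.prodMk measurable_id)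
  have hK' : Measurable fun p : Y × X => K p.2 p.1 := hK.comp measurable_swap
  set N := ∫⁻ x, G x * w x ∂μ with hN
  -- Cauchy-Schwarz with the weight `w`
  have cs : ∀ y, (∫⁻ x, G x * K x y ∂μ) ^ 2 ≤ N * ∫⁻ x, G x * (w x)⁻¹ * K x y ^ 2 ∂μ := fun y => by
    have h := ENNReal.lintegral_mul_norm_pow_le (μ := μ) (f := fun x => G x * w x)
      (g := fun x => G x * (w x)⁻¹ * K x y ^ 2) (p := 1 / 2) (q := 1 / 2)
      (hG.mul hw).aemeasurable ((hG.mul hw.inv).mul ((hKy y).pow_const 2)).aemeasurable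
      (by norm_num) (by norm_num) (by norm_num)
    have e : ∀ x, (G x * w x) ^ (1 / 2 : ℝ) * (G x * (w x)⁻¹ * K x y ^ 2) ^ (1 / 2 : ℝ) =
        G x * K x y := fun x => by
      rw [← ENNReal.mul_rpow_of_nonneg _ _ (by norm_num)]
      have : G x * w x * (G x * (w x)⁻¹ * K x y ^ 2) = (G x * K x y) ^ 2 := by
        calc _ = (w x * (w x)⁻¹) * (G x * K x y) ^ 2 := by ring
          _ = _ := by rw [ENNReal.mul_inv_cancel (hw0 x) (hwt x), one_mul]
      rw [this, ← ENNReal.rpow_natCast, ← ENNReal.rpow_mul]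
      norm_num
    simp only [e] at h
    calc _ ≤ (N ^ (1 / 2 : ℝ) * (∫⁻ x, G x * (w x)⁻¹ * K x y ^ 2 ∂μ) ^ (1 / 2 : ℝ)) ^ 2 := by
          gcongr
      _ = _ := by
          rw [mul_pow, ← ENNReal.rpow_natCast, ← ENNReal.rpow_natCast, ← ENNReal.rpow_mul,
            ← ENNReal.rpow_mul]
          norm_num
  calc _ ≤ ∫⁻ y, N * ∫⁻ x, G x * (w x)⁻¹ * K x y ^ 2 ∂μ ∂ν := lintegral_mono cs
    _ = N * ∫⁻ y, ∫⁻ x, G x * (w x)⁻¹ * K x y ^ 2 ∂μ ∂ν := by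
        refine lintegral_const_mul _ (Measurable.lintegral_prod_right'
          (f := fun p : Y × X => G p.2 * (w p.2)⁻¹ * K p.2 p.1 ^ 2) (by fun_prop))
    _ = N * ∫⁻ x, ∫⁻ y, G x * (w x)⁻¹ * K x y ^ 2 ∂ν ∂μ := by
        rw [lintegral_lintegral_swap]
        exact (by fun_prop : Measurable fun p : Y × X =>
          G p.2 * (w p.2)⁻¹ * K p.2 p.1 ^ 2).aemeasurable
    _ ≤ N * ∫⁻ x, C * (G x * w x) ∂μ := by
        gcongr with x
        rw [lintegral_const_mul _ ((hKx x).pow_const 2)]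
        calc _ ≤ G x * (w x)⁻¹ * (C * w x ^ 2) := by gcongr; exact hC x
          _ = C * (G x * w x) * (w x * (w x)⁻¹) := by ring
          _ = _ := by rw [ENNReal.mul_inv_cancel (hw0 x) (hwt x), mul_one]
    _ = _ := by rw [lintegral_const_mul _ (by fun_prop)]; ring

theorem min_one_le_rpow {X θ : ℝ} (hX : 0 < X) (h0 : 0 ≤ θ) (h1 : θ ≤ 1) : min 1 X ≤ X ^ θ := by
  rcases le_total X 1 with h | h
  · rw [min_eq_right h]
    simpa using Real.rpow_le_rpow_of_exponent_ge hX h h1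
  · rw [min_eq_left h]
    exact Real.one_le_rpow h h0

variable {V : Type*} [NormedAddCommGroup V] [InnerProductSpace ℝ V] [FiniteDimensional ℝ V]

variable (V) in
/-- A smooth compactly supported function equal to `1` on the unit ball. -/
noncomputable def unitCutoff : ContDiffBump (0 : V) := ⟨1, 2, one_pos, one_lt_two⟩

variable (V) in
/-- The complex valued Schwartz version of `unitCutoff`. -/
noncomputable def unitCutoffSchwartz : SchwartzMap V ℂ :=
  (show HasCompactSupport fun y : V => ((unitCutoff V y : ℝ) : ℂ) from
    (unitCutoff V).hasCompactSupport.comp_left Complex.ofReal_zero).toSchwartzMap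
    (Complex.ofRealCLM.contDiff.comp (unitCutoff V).contDiff)

theorem unitCutoffSchwartz_apply (y : V) : unitCutoffSchwartz V y = ((unitCutoff V y : ℝ) : ℂ) :=
  rfl

theorem unitCutoffSchwartz_mul {g : V → ℂ} (hg : tsupport g ⊆ Metric.closedBall 0 1) (y : V) :
    unitCutoffSchwartz V y * g y = g y := by
  by_cases hy : y ∈ tsupport g
  · rw [unitCutoffSchwartz_apply, (unitCutoff V).one_of_mem_closedBall (hg hy)]
    simp
  · simp [image_eq_zero_of_notMem_tsupport hy]

variable [MeasurableSpace V] [BorelSpace V]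

theorem integrable_of_tsupport_subset {g : V → ℂ} (hg : Continuous g)
    (hs : tsupport g ⊆ Metric.closedBall 0 1) : Integrable g :=
  hg.integrable_of_hasCompactSupport
    ((isCompact_closedBall (0 : V) 1).of_isClosed_subset (isClosed_tsupport g) hs)

variable (V) in
/-- A radial function supported in the unit ball is a superposition of truncated spherical waves,
so its `L²` norm is controlled by those of the waves. -/
theorem exists_eLpNorm_two_le [Nontrivial V] : ∃ C : ℝ≥0, ∀ g : V → ℂ, Continuous g →
    Integrable (𝓕 g) → (∀ x y, ‖x‖ = ‖y‖ → g x = g y) → tsupport g ⊆ Metric.closedBall 0 1 →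
    eLpNorm g 2 volume ≤ C * ∫⁻ ξ, ‖𝓕 g ξ‖ₑ *
      ENNReal.ofReal ((1 + ‖ξ‖) ^ (-((Module.finrank ℝ V - 1 : ℝ) / 2))) := by
  obtain ⟨C, hC⟩ := exists_lintegral_sq_sphericalWave_le (unitCutoff V).contDiff
    (unitCutoff V).hasCompactSupport
  refine ⟨NNReal.sqrt C, fun g hg hĝ hrad hs => ?_⟩
  have hgi := integrable_of_tsupport_subset hg hs
  have hcg : Continuous (𝓕 g) := continuous_fourier_of_integrable hgi
  set w : V → ℝ≥0∞ := fun ξ =>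
    ENNReal.ofReal ((1 + ‖ξ‖) ^ (-((Module.finrank ℝ V - 1 : ℝ) / 2))) with hw
  set K : V → V → ℝ≥0∞ := fun ξ y => ‖((unitCutoff V y : ℝ) : ℂ) * sphericalWave ‖ξ‖ y‖ₑ with hK
  have hpt : ∀ y, ‖g y‖ₑ ≤ ∫⁻ ξ, ‖𝓕 g ξ‖ₑ * K ξ y := fun y => by
    have e : g y = ∫ ξ, 𝓕 g ξ * (((unitCutoff V y : ℝ) : ℂ) * sphericalWave ‖ξ‖ y) := by
      calc g y = ((unitCutoff V y : ℝ) : ℂ) * 𝓕⁻ (𝓕 g) y := by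
            rw [hg.fourierInv_fourier_eq hgi hĝ]; exact (unitCutoffSchwartz_mul hs y).symm
        _ = ((unitCutoff V y : ℝ) : ℂ) * ∫ ξ, 𝓕 g ξ * sphericalWave ‖ξ‖ y := by
            have := integral_radial_mul (h := fun ξ : V => (Real.fourierChar (inner ℝ y ξ) : ℂ))
              (C := 1) hĝ (fun x y h => fourier_eq_of_norm_eq hrad h) (by fun_prop)
              (fun ξ => (Circle.norm_coe _).le)
            have e0 : 𝓕⁻ (𝓕 g) y = ∫ ξ, 𝓕 g ξ * (Real.fourierChar (inner ℝ y ξ) : ℂ) := by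
              rw [fourierInv_eq_integral_mul]
              congr with ξ
              rw [real_inner_comm]
            rw [e0, this]
            rfl
        _ = _ := by
            rw [← integral_const_mul]
            congr with ξ
            ring
    calc ‖g y‖ₑ = ‖∫ ξ, 𝓕 g ξ * (((unitCutoff V y : ℝ) : ℂ) * sphericalWave ‖ξ‖ y)‖ₑ := by
          rw [← e]
      _ ≤ ∫⁻ ξ, ‖𝓕 g ξ * (((unitCutoff V y : ℝ) : ℂ) * sphericalWave ‖ξ‖ y)‖ₑ :=
          enorm_integral_le_lintegral_enorm _
      _ = _ := by simp only [enorm_mul, hK]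
  have hKm : Measurable (Function.uncurry K) := by
    have h1 : Continuous fun p : V × V => sphericalWave ‖p.1‖ p.2 :=
      continuous_sphericalWave.comp (by fun_prop : Continuous fun p : V × V => (‖p.1‖, p.2))
    have h2 : Continuous fun p : V × V => ((unitCutoff V p.2 : ℝ) : ℂ) :=
      Complex.continuous_ofReal.comp ((unitCutoff V).continuous.comp continuous_snd)
    exact (h2.mul h1).enorm.measurable
  have hmain := lintegral_sq_lintegral_mul_le (μ := (volume : Measure V))
    (ν := (volume : Measure V)) (G := fun ξ => ‖𝓕 g ξ‖ₑ) (w := w) (K := K) (C := C)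
    hcg.enorm.measurable (by fun_prop) hKm
    (fun ξ => by simp only [hw, ne_eq, ENNReal.ofReal_eq_zero, not_le]; positivity)
    (fun ξ => ENNReal.ofReal_ne_top) (fun ξ => by
      refine (hC ‖ξ‖ (norm_nonneg _)).trans (le_of_eq ?_)
      rw [hw, ← ENNReal.ofReal_pow (by positivity), ← Real.rpow_natCast,
        ← Real.rpow_mul (by positivity)]
      congr 3
      push_cast
      ring)
  have hsq : eLpNorm g 2 volume ^ 2 ≤ (NNReal.sqrt C * ∫⁻ ξ, ‖𝓕 g ξ‖ₑ * w ξ) ^ 2 := by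
    have e : eLpNorm g 2 volume ^ 2 = ∫⁻ y, ‖g y‖ₑ ^ 2 := by
      rw [eLpNorm_eq_lintegral_rpow_enorm_toReal (by norm_num) (by norm_num),
        ← ENNReal.rpow_natCast, ← ENNReal.rpow_mul]
      simp
    rw [e, mul_pow, ← ENNReal.coe_pow, NNReal.sq_sqrt]
    refine (lintegral_mono fun y => ?_).trans hmain
    gcongr
    exact hpt y
  exact (ENNReal.pow_le_pow_left_iff two_ne_zero).1 hsq

variable (V) in
/-- Uniform bound for the evolution of radial data, interpolated between the trivial one and the
dispersive one frequency by frequency. -/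
theorem exists_norm_integral_gaussianWave_le [Nontrivial V] : ∃ C : ℝ≥0, ∀ g : V → ℂ,
    Continuous g → Integrable (𝓕 g) → (∀ x y, ‖x‖ = ‖y‖ → g x = g y) →
    tsupport g ⊆ Metric.closedBall 0 1 →
    ∀ b : ℂ, 0 ≤ b.re → b ≠ 0 → ∀ θ : ℝ, 0 ≤ θ → θ ≤ 1 → ∀ x,
    ‖∫ η, 𝓕 g η * gaussianWave b x η‖ₑ ≤ C * ∫⁻ ξ, ‖𝓕 g ξ‖ₑ * ENNReal.ofReal
      (((Real.pi / ‖b‖) ^ ((Module.finrank ℝ V : ℝ) / 2) *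
        (1 + ‖ξ‖) ^ (-((Module.finrank ℝ V - 1 : ℝ) / 2))) ^ θ) := by
  obtain ⟨C, hC⟩ := exists_lintegral_sphericalWave_le (unitCutoff V).contDiff
    (unitCutoff V).hasCompactSupport
  set k := 𝓕 (unitCutoffSchwartz V : V → ℂ) with hk
  have hki : Integrable k := by
    rw [hk, ← SchwartzMap.fourier_coe]; exact SchwartzMap.integrable _
  set A : ℝ := ∫ η, ‖k η‖ with hA
  refine ⟨max A.toNNReal C, fun g hg hĝ hrad hs b hb hb0 θ hθ0 hθ1 x => ?_⟩
  have hgi := integrable_of_tsupport_subset hg hs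
  rw [integral_conv_mul_eq hĝ hki (continuous_gaussianWave b x) (norm_gaussianWave_le hb x)
    (fourier_eq_integral_fourier_mul hg hgi hĝ (unitCutoffSchwartz V).integrable
      (unitCutoffSchwartz_mul hs))]
  change ‖∫ ξ, 𝓕 g ξ * packetFlow k b x ξ‖ₑ ≤ _
  rw [integral_radial_mul hĝ (fun x y h => fourier_eq_of_norm_eq hrad h)
    (continuous_packetFlow hki hb x) (norm_packetFlow_le hki hb x), ← lintegral_const_mul'
    _ _ ENNReal.coe_ne_top]
  refine (enorm_integral_le_lintegral_enorm _).trans (lintegral_mono fun ξ => ?_)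
  rw [enorm_mul, mul_left_comm]
  gcongr
  set T := (Real.pi / ‖b‖) ^ ((Module.finrank ℝ V : ℝ) / 2) with hT
  set R := (1 + ‖ξ‖) ^ (-((Module.finrank ℝ V - 1 : ℝ) / 2)) with hR
  have hbn : 0 < ‖b‖ := norm_pos_iff.2 hb0
  have hTp : 0 < T := Real.rpow_pos_of_pos (div_pos Real.pi_pos hbn) _
  have hRp : 0 < R := by positivity
  have h1 : ‖sphereMean (packetFlow k b x) ‖ξ‖‖ ≤ A :=
    norm_sphereMean_le (norm_packetFlow_le hki hb x) _
  have hw : Integrable fun y : V => unitCutoffSchwartz V y * sphericalWave ‖ξ‖ y := by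
    refine (unitCutoffSchwartz V).integrable.mul_bdd (c := 1) ?_
      (.of_forall fun y => norm_sphericalWave_le _ y)
    exact (continuous_sphericalWave.comp
      (by fun_prop : Continuous fun y : V => (‖ξ‖, y))).aestronglyMeasurable
  have h2 : ∫ y, ‖unitCutoffSchwartz V y * sphericalWave ‖ξ‖ y‖ ≤ C * R := by
    rw [integral_norm_eq_lintegral_enorm hw.1]
    refine ENNReal.toReal_le_of_le_ofReal (by positivity) ?_
    rw [ENNReal.ofReal_mul C.coe_nonneg, ENNReal.ofReal_coe_nnreal]
    exact hC ‖ξ‖ (norm_nonneg _)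
  have h3 : ‖sphereMean (packetFlow k b x) ‖ξ‖‖ ≤ T * (C * R) :=
    (norm_sphereMean_packetFlow_le (unitCutoffSchwartz V).integrable hki hb hb0 x ‖ξ‖).trans
      (mul_le_mul_of_nonneg_left h2 hTp.le)
  set D : ℝ≥0 := max A.toNNReal C with hD
  have hAD : A ≤ D := (Real.le_coe_toNNReal A).trans (NNReal.coe_le_coe.2 (le_max_left _ _))
  have hCD : (C : ℝ) ≤ D := NNReal.coe_le_coe.2 (le_max_right _ _)
  have h4 : ‖sphereMean (packetFlow k b x) ‖ξ‖‖ ≤ D * (T * R) ^ θ := by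
    refine le_trans ?_ (mul_le_mul_of_nonneg_left (min_one_le_rpow (mul_pos hTp hRp) hθ0 hθ1)
      D.coe_nonneg)
    rw [mul_min_of_nonneg _ _ D.coe_nonneg, mul_one]
    refine le_min (h1.trans hAD) (h3.trans ?_)
    calc T * (C * R) = C * (T * R) := by ring
      _ ≤ _ := by gcongr
  rw [← ofReal_norm, ← ENNReal.ofReal_coe_nnreal, ← ENNReal.ofReal_mul D.coe_nonneg]
  exact ENNReal.ofReal_le_ofReal h4

end Flow

/-! ### Interpolation and integrability in time -/

section Interpolation

/-- Interpolation of `L^σ` between `L²` and `L^∞`; `1/⊤ = 0` covers `σ = ⊤`. -/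
theorem eLpNorm_le_eLpNorm_two_rpow {X : Type*} [MeasurableSpace X] {μ : Measure X} {f : X → ℂ}
    (hf : AEStronglyMeasurable f μ) {S : ℝ≥0∞} (hS : ∀ x, ‖f x‖ₑ ≤ S) {σ : ℝ≥0∞} (hσ : 2 ≤ σ) :
    eLpNorm f σ μ ≤ S ^ (1 - 2 * (1 / σ).toReal) * eLpNorm f 2 μ ^ (2 * (1 / σ).toReal) := by
  rcases eq_or_ne σ ⊤ with rfl | ht
  · simp only [ENNReal.div_top, ENNReal.toReal_zero, mul_zero, sub_zero, ENNReal.rpow_one,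
      ENNReal.rpow_zero, mul_one]
    exact eLpNormEssSup_le_of_ae_enorm_bound (.of_forall hS)
  have h0 : σ ≠ 0 := fun h => by simp [h] at hσ
  set p := σ.toReal with hp
  have hp2 : 2 ≤ p := by simpa using ENNReal.toReal_mono ht hσ
  have hpp : 0 < p := by linarith
  have hb : (1 / σ).toReal = 1 / p := by simp [hp]
  rw [hb, eLpNorm_eq_lintegral_rpow_enorm_toReal h0 ht,
    eLpNorm_eq_lintegral_rpow_enorm_toReal two_ne_zero ENNReal.ofNat_ne_top]
  have h1 : ∫⁻ x, ‖f x‖ₑ ^ p ∂μ ≤ S ^ (p - 2) * ∫⁻ x, ‖f x‖ₑ ^ (2 : ℝ) ∂μ := by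
    rw [← lintegral_const_mul'' _ (hf.enorm.pow_const _)]
    refine lintegral_mono fun x => ?_
    calc ‖f x‖ₑ ^ p = ‖f x‖ₑ ^ (p - 2) * ‖f x‖ₑ ^ (2 : ℝ) := by
          rw [← ENNReal.rpow_add_of_nonneg _ _ (by linarith) (by norm_num)]; simp
      _ ≤ _ := by
          exact mul_le_mul_left (ENNReal.rpow_le_rpow (hS x) (by linarith)) _
  calc _ ≤ (S ^ (p - 2) * ∫⁻ x, ‖f x‖ₑ ^ (2 : ℝ) ∂μ) ^ (1 / p) := by gcongr
    _ = _ := by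
        rw [ENNReal.mul_rpow_of_nonneg _ _ (by positivity), ← ENNReal.rpow_mul, ← ENNReal.rpow_mul]
        congr 2
        · field_simp
        · simp

theorem integrable_min_rpow_abs {κ : ℝ} (hκ : 0 < κ) :
    Integrable fun t : ℝ => min (|t| ^ (-1 + κ)) (|t| ^ (-1 - κ)) := by
  have h := (integrable_fun_norm_addHaar (volume : Measure ℝ)
    (f := fun y => min (y ^ (-1 + κ)) (y ^ (-1 - κ)))).2 ?_
  · simpa using h
  have hm : Measurable fun y : ℝ => min (y ^ (-1 + κ)) (y ^ (-1 - κ)) := by fun_prop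
  simp only [Module.finrank_self, Nat.sub_self, pow_zero, one_smul]
  rw [← Set.Ioc_union_Ioi_eq_Ioi zero_le_one]
  refine IntegrableOn.union ?_ ?_
  · have i1 : IntegrableOn (fun y : ℝ => y ^ (-1 + κ)) (Set.Ioc 0 1) :=
      (intervalIntegral.intervalIntegrable_rpow' (by linarith)).1
    refine i1.mono' hm.aestronglyMeasurable ?_
    filter_upwards [ae_restrict_mem measurableSet_Ioc] with y hy
    have hy0 := hy.1.le
    rw [Real.norm_of_nonneg (by positivity)]
    exact min_le_left _ _
  · have i1 : IntegrableOn (fun y : ℝ => y ^ (-1 - κ)) (Set.Ioi 1) :=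
      integrableOn_Ioi_rpow_of_lt (by linarith) one_pos
    refine i1.mono' hm.aestronglyMeasurable ?_
    filter_upwards [ae_restrict_mem measurableSet_Ioi] with y hy
    have hy0 : (0 : ℝ) ≤ y := zero_le_one.trans hy.out.le
    rw [Real.norm_of_nonneg (by positivity)]
    exact min_le_right _ _

end Interpolation

/-! ### The Schrödinger flow at a fixed time -/

section Schrodinger

variable {d : ℕ}

theorem one_le_japaneseBracket (ξ : EuclideanSpace ℝ (Fin d)) : 1 ≤ japaneseBracket ξ :=
  Real.one_le_sqrt.2 (by nlinarith [sq_nonneg ‖ξ‖])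

theorem japaneseBracket_le (ξ : EuclideanSpace ℝ (Fin d)) : japaneseBracket ξ ≤ 1 + ‖ξ‖ :=
  Real.sqrt_le_iff.2 ⟨by positivity, by nlinarith [norm_nonneg ξ]⟩

theorem one_add_norm_rpow_le (ξ : EuclideanSpace ℝ (Fin d)) {q s : ℝ} (hq : 0 ≤ q) (hs : -q ≤ s) :
    (1 + ‖ξ‖) ^ (-q) ≤ japaneseBracket ξ ^ s :=
  (Real.rpow_le_rpow_of_nonpos (by linarith [one_le_japaneseBracket ξ]) (japaneseBracket_le ξ)
    (by linarith)).trans (Real.rpow_le_rpow_of_exponent_le (one_le_japaneseBracket ξ) hs)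

theorem weightedFourierNorm_eq (s : ℝ) (g : EuclideanSpace ℝ (Fin d) → ℂ) :
    weightedFourierNorm s g = ∫⁻ ξ, ‖𝓕 g ξ‖ₑ * ENNReal.ofReal (japaneseBracket ξ ^ s) := by
  rw [weightedFourierNorm, eLpNorm_one_eq_lintegral_enorm]
  congr with ξ
  rw [enorm_mul, mul_comm, ← ofReal_norm (((japaneseBracket ξ ^ s : ℝ) : ℂ)), Complex.norm_real,
    Real.norm_of_nonneg (Real.rpow_nonneg (zero_le_one.trans (one_le_japaneseBracket ξ)) s)]

theorem schrodingerFlow_apply (t : ℝ) (g : EuclideanSpace ℝ (Fin d) → ℂ)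
    (x : EuclideanSpace ℝ (Fin d)) : schrodingerFlow t g x =
      ∫ η, 𝓕 g η * gaussianWave (4 * (Real.pi : ℂ) ^ 2 * Complex.I * t) x η := by
  rw [schrodingerFlow, fourierInv_eq_integral_mul]
  congr with η
  rw [gaussianWave, neg_mul]
  ring

theorem re_schrodinger_exponent (t : ℝ) : (4 * (Real.pi : ℂ) ^ 2 * Complex.I * t).re = 0 := by
  have : (4 * (Real.pi : ℂ) ^ 2 * Complex.I * t) = ((4 * Real.pi ^ 2 * t : ℝ) : ℂ) * Complex.I := by
    push_cast; ring
  rw [this, Complex.re_ofReal_mul, Complex.I_re, mul_zero]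

theorem norm_schrodinger_exponent (t : ℝ) :
    ‖4 * (Real.pi : ℂ) ^ 2 * Complex.I * t‖ = 4 * Real.pi ^ 2 * |t| := by
  simp [abs_of_pos Real.pi_pos]

theorem norm_schrodinger_symbol (t : ℝ) (ξ : EuclideanSpace ℝ (Fin d)) :
    ‖Complex.exp (-(4 * (Real.pi : ℂ) ^ 2 * Complex.I * (t : ℂ) * ((‖ξ‖ : ℝ) : ℂ) ^ 2))‖ = 1 := by
  have : -(4 * (Real.pi : ℂ) ^ 2 * Complex.I * (t : ℂ) * ((‖ξ‖ : ℝ) : ℂ) ^ 2) =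
      ((-(4 * Real.pi ^ 2 * t * ‖ξ‖ ^ 2) : ℝ) : ℂ) * Complex.I := by
    push_cast; ring
  rw [this, Complex.norm_exp_ofReal_mul_I]

theorem integrable_symbol_mul (t : ℝ) {G : EuclideanSpace ℝ (Fin d) → ℂ} (hG : Integrable G) :
    Integrable fun ξ : EuclideanSpace ℝ (Fin d) =>
      Complex.exp (-(4 * (Real.pi : ℂ) ^ 2 * Complex.I * (t : ℂ) * ((‖ξ‖ : ℝ) : ℂ) ^ 2)) * G ξ :=
  hG.bdd_mul (c := 1) (by fun_prop) (.of_forall fun ξ => (norm_schrodinger_symbol t ξ).le)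

theorem continuous_schrodingerFlow (t : ℝ) {g : EuclideanSpace ℝ (Fin d) → ℂ}
    (hĝ : Integrable (𝓕 g)) : Continuous (schrodingerFlow t g) :=
  continuous_fourierInv_of_integrable (integrable_symbol_mul t hĝ)

/-- The flow preserves the `L²` norm. -/
theorem eLpNorm_two_schrodingerFlow_le (t : ℝ) {g : EuclideanSpace ℝ (Fin d) → ℂ}
    (hg : Continuous g) (hgi : Integrable g) (hĝ : Integrable (𝓕 g)) :
    eLpNorm (schrodingerFlow t g) 2 volume ≤ eLpNorm g 2 volume := by
  have hb : ∀ ξ, ‖𝓕 g ξ‖ ≤ ∫ y, ‖g y‖ := fun ξ =>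
    VectorFourier.norm_fourierIntegral_le_integral_norm _ _ _ _ _
  have h2 : MemLp (𝓕 g) 2 := hĝ.memLp_two_of_bound hb
  have hi := integrable_symbol_mul t hĝ
  have hn : ∀ ξ : EuclideanSpace ℝ (Fin d), ‖Complex.exp (-(4 * (Real.pi : ℂ) ^ 2 * Complex.I *
      (t : ℂ) * ((‖ξ‖ : ℝ) : ℂ) ^ 2)) * 𝓕 g ξ‖ = ‖𝓕 g ξ‖ := fun ξ => by
    rw [norm_mul, norm_schrodinger_symbol, one_mul]
  rw [schrodingerFlow, eLpNorm_fourierInv_two hi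
    (hi.memLp_two_of_bound fun ξ => (hn ξ).le.trans (hb ξ)), eLpNorm_congr_norm_ae (.of_forall hn),
    ← eLpNorm_fourierInv_two hĝ h2, hg.fourierInv_fourier_eq hgi hĝ]

/-- Fixed-time estimate: the `L^σ` norm decays like `|t|^{-p}` at the price of the weight
`⟨ξ⟩^s`, for every `p` up to the dispersive rate `d (1/2 - 1/σ)`. -/
theorem exists_eLpNorm_schrodingerFlow_le (hd : 2 ≤ d) {σ : ℝ≥0∞} (hσ : 2 ≤ σ) {p s : ℝ}
    (hp : 0 ≤ p) (hδ : 0 < 1 - 2 * (1 / σ).toReal)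
    (hpd : p ≤ d / 2 * (1 - 2 * (1 / σ).toReal)) (hs : -(((d : ℝ) - 1) / 2) ≤ s)
    (hs' : -(((d : ℝ) - 1) / d * p) ≤ s) :
    ∃ C : ℝ≥0, ∀ g : EuclideanSpace ℝ (Fin d) → ℂ,
      Continuous g → Integrable (𝓕 g) volume → IsRadial g →
      tsupport g ⊆ Metric.closedBall 0 1 → ∀ t : ℝ, t ≠ 0 →
      eLpNorm (schrodingerFlow t g) σ volume ≤
        C * ENNReal.ofReal (|t| ^ (-p)) * weightedFourierNorm s g := by
  have hd0 : (2 : ℝ) ≤ d := by exact_mod_cast hd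
  have : Nonempty (Fin d) := ⟨⟨0, by omega⟩⟩
  obtain ⟨C₁, hC₁⟩ := exists_eLpNorm_two_le (EuclideanSpace ℝ (Fin d))
  obtain ⟨C₂, hC₂⟩ := exists_norm_integral_gaussianWave_le (EuclideanSpace ℝ (Fin d))
  simp only [finrank_euclideanSpace, Fintype.card_fin] at hC₁ hC₂
  set β : ℝ := 2 * (1 / σ).toReal with hβ
  have hβ0 : 0 ≤ β := by positivity
  -- the exponent for which the dispersive factor `|t|^{-dθ/2}`, raised to `1 - β`, is `|t|^{-p}`
  set θ : ℝ := 2 * p / (d * (1 - β)) with hθ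
  have hθ0 : 0 ≤ θ := by positivity
  have hθ1 : θ ≤ 1 := by
    rw [hθ, div_le_one (by positivity)]; linarith
  have hθp : (d : ℝ) / 2 * θ * (1 - β) = p := by
    rw [hθ]; field_simp
  have hθs : -(((d : ℝ) - 1) / 2 * θ) ≤ s := by
    refine le_trans ?_ hs'
    have h1 : p ≤ (d : ℝ) / 2 * θ := by
      rw [← hθp]
      exact mul_le_of_le_one_right (by positivity) (by linarith)
    have h2 : ((d : ℝ) - 1) / d * p ≤ ((d : ℝ) - 1) / d * ((d : ℝ) / 2 * θ) :=
      mul_le_mul_of_nonneg_left h1 (div_nonneg (by linarith) (by linarith))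
    have h3 : ((d : ℝ) - 1) / d * ((d : ℝ) / 2 * θ) = ((d : ℝ) - 1) / 2 * θ := by field_simp
    linarith
  set D : ℝ := (1 / (4 * Real.pi)) ^ ((d : ℝ) / 2 * θ) with hD
  have hD0 : 0 ≤ D := by positivity
  refine ⟨(C₂ * D.toNNReal) ^ (1 - β) * C₁ ^ β, fun g hg hĝ hrad hs t ht => ?_⟩
  have hgi := integrable_of_tsupport_subset hg hs
  set N := weightedFourierNorm s g with hN
  have hN' := weightedFourierNorm_eq s g
  have b2 : eLpNorm (schrodingerFlow t g) 2 volume ≤ C₁ * N := by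
    refine (eLpNorm_two_schrodingerFlow_le t hg hgi hĝ).trans ((hC₁ g hg hĝ hrad hs).trans ?_)
    rw [hN, hN']
    gcongr with ξ
    exact one_add_norm_rpow_le ξ (by linarith) (by assumption)
  have btop : ∀ x, ‖schrodingerFlow t g x‖ₑ ≤
      (C₂ * D.toNNReal : ℝ≥0) * ENNReal.ofReal (|t| ^ (-((d : ℝ) / 2 * θ))) * N := fun x => by
    rw [schrodingerFlow_apply]
    have hb0 : 4 * (Real.pi : ℂ) ^ 2 * Complex.I * t ≠ 0 := by simp [ht]
    have htp : 0 < |t| := abs_pos.2 ht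
    have hint : ∫⁻ ξ, ‖𝓕 g ξ‖ₑ * ENNReal.ofReal
        (((Real.pi / ‖4 * (Real.pi : ℂ) ^ 2 * Complex.I * t‖) ^ ((d : ℝ) / 2) *
          (1 + ‖ξ‖) ^ (-(((d : ℝ) - 1) / 2))) ^ θ) ≤
        ENNReal.ofReal D * ENNReal.ofReal (|t| ^ (-((d : ℝ) / 2 * θ))) * N := by
      rw [hN, hN', ← ENNReal.ofReal_mul hD0, ← lintegral_const_mul' _ _ ENNReal.ofReal_ne_top]
      refine lintegral_mono fun ξ => ?_
      beta_reduce
      rw [mul_left_comm, ← ENNReal.ofReal_mul (by positivity)]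
      gcongr
      rw [norm_schrodinger_exponent, Real.mul_rpow (by positivity) (by positivity),
        ← Real.rpow_mul (by positivity), ← Real.rpow_mul (by positivity)]
      have e1 : Real.pi / (4 * Real.pi ^ 2 * |t|) = 1 / (4 * Real.pi) * |t|⁻¹ := by
        field_simp
      rw [e1, Real.mul_rpow (by positivity) (by positivity), Real.inv_rpow htp.le,
        ← Real.rpow_neg htp.le, neg_mul]
      gcongr
      exact one_add_norm_rpow_le ξ (mul_nonneg (by linarith) hθ0) hθs
    calc _ ≤ (C₂ : ℝ≥0∞) * _ :=
          hC₂ g hg hĝ hrad hs _ (re_schrodinger_exponent t).ge hb0 θ hθ0 hθ1 x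
      _ ≤ C₂ * (ENNReal.ofReal D * ENNReal.ofReal (|t| ^ (-((d : ℝ) / 2 * θ))) * N) :=
          mul_le_mul_right hint _
      _ = _ := by
          rw [ENNReal.coe_mul, show ((D.toNNReal : ℝ≥0) : ℝ≥0∞) = ENNReal.ofReal D from rfl]
          ring
  refine (eLpNorm_le_eLpNorm_two_rpow (continuous_schrodingerFlow t hĝ).aestronglyMeasurable
    btop hσ).trans ?_
  rw [← hβ]
  have hNN : N ^ (1 - β) * N ^ β = N := by
    rw [← ENNReal.rpow_add_of_nonneg _ _ hδ.le hβ0]; simp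
  have htt : ENNReal.ofReal (|t| ^ (-((d : ℝ) / 2 * θ))) ^ (1 - β) =
      ENNReal.ofReal (|t| ^ (-p)) := by
    rw [ENNReal.ofReal_rpow_of_nonneg (by positivity) hδ.le, ← Real.rpow_mul (abs_nonneg t),
      neg_mul, hθp]
  have hcoe : (((C₂ * D.toNNReal) ^ (1 - β) * C₁ ^ β : ℝ≥0) : ℝ≥0∞) =
      ((C₂ * D.toNNReal : ℝ≥0) : ℝ≥0∞) ^ (1 - β) * (C₁ : ℝ≥0∞) ^ β := by
    rw [ENNReal.coe_mul, ENNReal.coe_rpow_of_nonneg _ hδ.le, ENNReal.coe_rpow_of_nonneg _ hβ0]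
  calc _ ≤ ((C₂ * D.toNNReal : ℝ≥0) * ENNReal.ofReal (|t| ^ (-((d : ℝ) / 2 * θ))) * N) ^ (1 - β) *
        (C₁ * N) ^ β := by gcongr
    _ = _ := by
        rw [ENNReal.mul_rpow_of_nonneg _ _ hδ.le, ENNReal.mul_rpow_of_nonneg _ _ hδ.le,
          ENNReal.mul_rpow_of_nonneg _ _ hβ0, htt, hcoe]
        conv_rhs => rw [← hNN]
        ring

end Schrodinger

/-! ### Summation in time -/

/-- The hypotheses on the exponents, read in terms of `a = 1/ϱ` and `1 - 2/σ`. -/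
theorem exponent_bounds {d : ℕ} (hd : 2 ≤ d) {ϱ σ : ℝ≥0∞} (hϱ : 2 ≤ ϱ) (hσ : 2 ≤ σ)
    (h₁ : 2 / ϱ + (d : ℝ≥0∞) / σ ≤ (d : ℝ≥0∞) / 2)
    (h₂ : 1 / ϱ + ((d : ℝ≥0∞) - 1) / σ < ((d : ℝ≥0∞) - 1) / 2) :
    (1 / ϱ).toReal ≤ 1 / 2 ∧ 0 < 1 - 2 * (1 / σ).toReal ∧
      (1 / ϱ).toReal < d / 2 * (1 - 2 * (1 / σ).toReal) := by
  have hd0 : (2 : ℝ) ≤ d := by exact_mod_cast hd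
  have hϱ' : ϱ⁻¹ ≤ 2⁻¹ := ENNReal.inv_le_inv.2 hϱ
  have hσ' : σ⁻¹ ≤ 2⁻¹ := ENNReal.inv_le_inv.2 hσ
  have h2 : (2⁻¹ : ℝ≥0∞) ≠ ⊤ := by simp
  have hϱt : ϱ⁻¹ ≠ ⊤ := ne_top_of_le_ne_top h2 hϱ'
  have hσt : σ⁻¹ ≠ ⊤ := ne_top_of_le_ne_top h2 hσ'
  have hd1 : (d : ℝ≥0∞) - 1 = ((d - 1 : ℕ) : ℝ≥0∞) := by simp
  rw [hd1] at h₂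
  simp only [div_eq_mul_inv, one_mul] at h₁ h₂ ⊢
  have r1 := ENNReal.toReal_mono (ENNReal.mul_ne_top (ENNReal.natCast_ne_top d) h2) h₁
  have r2 := ENNReal.toReal_strict_mono (ENNReal.mul_ne_top (ENNReal.natCast_ne_top (d - 1)) h2) h₂
  have r3 := ENNReal.toReal_mono h2 hϱ'
  have r4 := ENNReal.toReal_mono h2 hσ'
  rw [ENNReal.toReal_add (ENNReal.mul_ne_top (by simp) hϱt)
    (ENNReal.mul_ne_top (ENNReal.natCast_ne_top _) hσt)] at r1
  rw [ENNReal.toReal_add hϱt (ENNReal.mul_ne_top (ENNReal.natCast_ne_top _) hσt)] at r2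
  have hcast : ((d - 1 : ℕ) : ℝ) = (d : ℝ) - 1 := by rw [Nat.cast_sub (by omega)]; simp
  simp only [ENNReal.toReal_mul, ENNReal.toReal_natCast, ENNReal.toReal_ofNat,
    ENNReal.toReal_inv ϱ, ENNReal.toReal_inv σ, hcast] at *
  have ha0 : 0 ≤ (ϱ.toReal)⁻¹ := by positivity
  rw [ENNReal.toReal_inv, ENNReal.toReal_ofNat] at *
  set a := (ϱ.toReal)⁻¹
  set b := (σ.toReal)⁻¹
  have hδ : 0 < 1 - 2 * b := by
    have : ((d : ℝ) - 1) * b < ((d : ℝ) - 1) * 2⁻¹ := by linarith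
    have := lt_of_mul_lt_mul_left this (by linarith)
    linarith
  refine ⟨r3, hδ, ?_⟩
  have : 0 < (d : ℝ) / 2 * (1 - 2 * b) := by positivity
  nlinarith

theorem proposition4p1 (d : ℕ) (hd : 2 ≤ d) (ϱ σ : ℝ≥0∞) (hϱ : 2 ≤ ϱ) (hσ : 2 ≤ σ)
    (h₁ : 2 / ϱ + (d : ℝ≥0∞) / σ ≤ (d : ℝ≥0∞) / 2)
    (h₂ : 1 / ϱ + ((d : ℝ≥0∞) - 1) / σ < ((d : ℝ≥0∞) - 1) / 2)
    (ε : ℝ) (hε : 0 < ε) :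
    ∃ C : ℝ≥0, ∀ g : EuclideanSpace ℝ (Fin d) → ℂ,
      Continuous g → Integrable (𝓕 g) volume → IsRadial g →
      tsupport g ⊆ Metric.closedBall 0 1 →
      mixedNorm ϱ σ (fun t => schrodingerFlow t g) ≤
        (C : ℝ≥0∞) *
          weightedFourierNorm (-(((d : ℝ) - 2) / ((d : ℝ) - 1)) * (1 / ϱ).toReal + ε) g := by
  obtain ⟨ha2, hδ, had⟩ := exponent_bounds hd hϱ hσ h₁ h₂
  have hd0 : (2 : ℝ) ≤ d := by exact_mod_cast hd
  set a := (1 / ϱ).toReal with ha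
  have ha0 : 0 ≤ a := ENNReal.toReal_nonneg
  set s : ℝ := -(((d : ℝ) - 2) / ((d : ℝ) - 1)) * a + ε with hs
  have hq0 : 0 ≤ ((d : ℝ) - 2) / ((d : ℝ) - 1) := div_nonneg (by linarith) (by linarith)
  have hq1 : ((d : ℝ) - 2) / ((d : ℝ) - 1) ≤ ((d : ℝ) - 1) / d := by
    rw [div_le_div_iff₀ (by linarith) (by linarith)]; nlinarith
  have hq2 : ((d : ℝ) - 1) / d ≤ 1 := by rw [div_le_one (by linarith)]; linarith
  have hs1 : -(((d : ℝ) - 1) / 2) ≤ s := by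
    have : ((d : ℝ) - 2) / ((d : ℝ) - 1) * a ≤ 1 * (1 / 2) :=
      mul_le_mul (hq1.trans hq2) ha2 ha0 zero_le_one
    rw [hs]; linarith
  -- a loss of at most `ε` in the power of `t` is affordable, since
  -- `(d - 2)/(d - 1) ≤ (d - 1)/d ≤ 1`
  have hs2 : ∀ p, a - ε ≤ p → -(((d : ℝ) - 1) / d * p) ≤ s := fun p hp => by
    have hq : 0 ≤ ((d : ℝ) - 1) / d := hq0.trans hq1
    have e1 : ((d : ℝ) - 2) / ((d : ℝ) - 1) * a ≤ ((d : ℝ) - 1) / d * a :=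
      mul_le_mul_of_nonneg_right hq1 ha0
    have e2 : ((d : ℝ) - 1) / d * (a - ε) ≤ ((d : ℝ) - 1) / d * p :=
      mul_le_mul_of_nonneg_left hp hq
    have e3 : ((d : ℝ) - 1) / d * ε ≤ 1 * ε := mul_le_mul_of_nonneg_right hq2 hε.le
    rw [hs]; linarith
  -- at `t = 0` the bounding power of `|t|` has a junk value
  have hae : ∀ᵐ t : ℝ, t ≠ 0 := by simp [ae_iff]
  have hϱ0 : ϱ ≠ 0 := fun h => by simp [h] at hϱ
  rcases eq_or_ne ϱ ⊤ with hϱt | hϱt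
  · have ha00 : a = 0 := by simp [ha, hϱt]
    obtain ⟨C, hC⟩ := exists_eLpNorm_schrodingerFlow_le (p := 0) hd hσ le_rfl hδ
      (by rw [← ha00]; exact had.le) hs1 (hs2 0 (by linarith))
    refine ⟨C, fun g hg hĝ hrad hsup => ?_⟩
    rw [mixedNorm, hϱt, eLpNorm_exponent_top]
    refine eLpNormEssSup_le_of_ae_enorm_bound ?_
    filter_upwards [hae] with t ht
    simpa using hC g hg hĝ hrad hsup t ht
  have hr0 : 0 < ϱ.toReal := ENNReal.toReal_pos hϱ0 hϱt
  have har : a = 1 / ϱ.toReal := by simp [ha]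
  have hapos : 0 < a := by rw [har]; positivity
  -- the decay rates `a ∓ η` are used for small and for large times
  obtain ⟨η, hη0, hη⟩ : ∃ η : ℝ, 0 < η ∧
      η ≤ min (min ε a) (d / 2 * (1 - 2 * (1 / σ).toReal) - a) :=
    ⟨_, lt_min (lt_min hε hapos) (by linarith), le_rfl⟩
  have hη1 : η ≤ ε := hη.trans ((min_le_left _ _).trans (min_le_left _ _))
  have hη2 : η ≤ a := hη.trans ((min_le_left _ _).trans (min_le_right _ _))
  have hη3 := hη.trans (min_le_right _ _)
  obtain ⟨C₁, hC₁⟩ := exists_eLpNorm_schrodingerFlow_le (p := a - η) hd hσ (by linarith) hδ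
    (by linarith) hs1 (hs2 _ (by linarith))
  obtain ⟨C₂, hC₂⟩ := exists_eLpNorm_schrodingerFlow_le (p := a + η) hd hσ (by linarith) hδ
    (by linarith) hs1 (hs2 _ (by linarith))
  set k : ℝ → ℝ≥0∞ := fun t => ENNReal.ofReal (min (|t| ^ (-(a - η))) (|t| ^ (-(a + η)))) with hk
  have hkint : ∫⁻ t, k t ^ ϱ.toReal < ⊤ := by
    have h := (integrable_min_rpow_abs (mul_pos hη0 hr0)).lintegral_lt_top
    refine lt_of_le_of_lt (lintegral_mono fun t => ?_) h
    rw [hk]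
    beta_reduce
    rw [ENNReal.ofReal_rpow_of_nonneg (by positivity) hr0.le]
    refine ENNReal.ofReal_le_ofReal (le_min ?_ ?_)
    · refine (Real.rpow_le_rpow (by positivity) (min_le_left _ _) hr0.le).trans (le_of_eq ?_)
      rw [← Real.rpow_mul (abs_nonneg t)]
      congr 1
      rw [har]; field_simp; ring
    · refine (Real.rpow_le_rpow (by positivity) (min_le_right _ _) hr0.le).trans (le_of_eq ?_)
      rw [← Real.rpow_mul (abs_nonneg t)]
      congr 1
      rw [har]; field_simp; ring
  set I := (∫⁻ t, k t ^ ϱ.toReal) ^ (1 / ϱ.toReal) with hI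
  have hIt : I ≠ ⊤ := ENNReal.rpow_ne_top_of_nonneg (by positivity) hkint.ne
  refine ⟨max C₁ C₂ * I.toNNReal, fun g hg hĝ hrad hsup => ?_⟩
  set N := weightedFourierNorm s g
  have hbound : ∀ t : ℝ, t ≠ 0 → eLpNorm (schrodingerFlow t g) σ volume ≤
      (max C₁ C₂ : ℝ≥0) * N * k t := fun t ht => by
    rcases min_choice (|t| ^ (-(a - η))) (|t| ^ (-(a + η))) with h | h
    · refine (hC₁ g hg hĝ hrad hsup t ht).trans ?_
      rw [hk, mul_right_comm]
      beta_reduce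
      rw [h]
      gcongr
      exact le_max_left _ _
    · refine (hC₂ g hg hĝ hrad hsup t ht).trans ?_
      rw [hk, mul_right_comm]
      beta_reduce
      rw [h]
      gcongr
      exact le_max_right _ _
  rw [mixedNorm, eLpNorm_eq_lintegral_rpow_enorm_toReal hϱ0 hϱt, ENNReal.coe_mul,
    ENNReal.coe_toNNReal hIt, hI]
  simp only [enorm_eq_self]
  calc _ ≤ (∫⁻ t, ((max C₁ C₂ : ℝ≥0) * N * k t) ^ ϱ.toReal) ^ (1 / ϱ.toReal) := by
        refine ENNReal.rpow_le_rpow (lintegral_mono_ae ?_) (by positivity)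
        filter_upwards [hae] with t ht
        exact ENNReal.rpow_le_rpow (hbound t ht) hr0.le
    _ = (((max C₁ C₂ : ℝ≥0) * N) ^ ϱ.toReal * ∫⁻ t, k t ^ ϱ.toReal) ^ (1 / ϱ.toReal) := by
        simp only [ENNReal.mul_rpow_of_nonneg _ (k _) hr0.le]
        rw [lintegral_const_mul _ (by fun_prop)]
    _ = _ := by
        rw [ENNReal.mul_rpow_of_nonneg _ _ (by positivity), ← ENNReal.rpow_mul,
          mul_one_div_cancel hr0.ne', ENNReal.rpow_one]
        ring
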